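/- Let $\mathbb{F}_q$ be a finite field, let $m,d,l,c,r$ be integers with $1\le l\le m$ and $1\le c\le d$, and suppose that $$\binom{m+d}{d}-\binom{m+d+1-l}{d}+\binom{m+d-l-c}{d-c-1}<r\le\binom{m+d}{d},$$ where $\binom{n}{-1}=0$. Let $F_1,\dots,F_r\in\mathbb{F}_q[x_0,\dots,x_m]$ be homogeneous polynomials of degree $d$ that are linearly independent over $\mathbb{F}_q$, and let $X=V(F_1,\dots,F_r)\subseteq\mathbb{P}^m(\overline{\mathbb{F}}_q)$ be their common zero set. Then $$\deg_{m-l}(X)\le c,$$ where $\deg_{i}(X)$ denotes the sum of the degrees of the irreducible components of $X$ (in the Zariski topology) that have dimension $i$. Here the degree of an irreducible closed subset $Z\subseteq\mathbb{P}^m(\overline{\mathbb{F}}_q)$ is $(\dim Z)!$ times the leading coefficient of its Hilbert polynomial. -/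

import Mathlib

open MvPolynomial

/-- The binomial coefficient with an integer lower index; it is `0` when the lower index is
negative. -/
def binom (n : ℕ) (k : ℤ) : ℕ := if 0 ≤ k then n.choose k.toNat else 0

/-- The set of points of the projective space `ℙ^m` over the field `k`: lines through the origin
in `k ^ (m + 1)`. -/
def ProjSpace (k : Type*) [Field k] (m : ℕ) : Type _ := Projectivization k (Fin (m + 1) → k)

namespace ProjSpace

/-- A nonzero vector of homogeneous coordinates of a point. -/
noncomputable def coords {k : Type*} [Field k] {m : ℕ} (p : ProjSpace k m) : Fin (m + 1) → k :=
  Projectivization.rep p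

/-- For a homogeneous polynomial, vanishing at a point does not depend on the choice of
homogeneous coordinates. -/
theorem eval_coords_mk_eq_zero_iff {k : Type*} [Field k] {m n : ℕ}
    {f : MvPolynomial (Fin (m + 1)) k} (hf : f.IsHomogeneous n) (v : Fin (m + 1) → k)
    (hv : v ≠ 0) :
    eval (coords (Projectivization.mk k v hv : ProjSpace k m)) f = 0 ↔ eval v f = 0 := by
  obtain ⟨a, ha⟩ := Projectivization.exists_smul_eq_mk_rep k v hv
  have h : coords (Projectivization.mk k v hv : ProjSpace k m) = (a : k) • v := ha.symm
  have h2 : eval ((a : k) • v) f = (a : k) ^ n * eval v f := by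
    rw [eval_eq, eval_eq, Finset.mul_sum]
    refine Finset.sum_congr rfl fun e he => ?_
    have hn : ∑ i ∈ e.support, e i = n := by
      have := hf (mem_support_iff.1 he)
      simpa [Finsupp.weight_apply, Finsupp.sum] using this
    simp only [Pi.smul_apply, smul_eq_mul, mul_pow, Finset.prod_mul_distrib,
      Finset.prod_pow_eq_pow_sum, hn]
    ring
  rw [h, h2]
  simp

/-- The vanishing set in `ℙ^m` of a set of (homogeneous) polynomials. -/
def vanishingSet {k : Type*} [Field k] {m : ℕ} (S : Set (MvPolynomial (Fin (m + 1)) k)) :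
    Set (ProjSpace k m) :=
  {p | ∀ f ∈ S, eval p.coords f = 0}

/-- The Zariski topology on `ℙ^m`: the closed sets are the projective algebraic sets, that is, the
vanishing sets of sets of homogeneous polynomials. -/
instance zariskiTopology (k : Type*) [Field k] (m : ℕ) : TopologicalSpace (ProjSpace k m) :=
  TopologicalSpace.ofClosed
    {Z | ∃ S : Set (MvPolynomial (Fin (m + 1)) k),
      (∀ f ∈ S, ∃ n, f.IsHomogeneous n) ∧ Z = vanishingSet S}
    ⟨{1}, by
      rintro f rfl
      exact ⟨0, isHomogeneous_one _ _⟩, by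
      ext p
      simp [vanishingSet]⟩
    (by
      intro A hA
      refine ⟨{f | (∃ n, f.IsHomogeneous n) ∧ ∃ Z ∈ A, ∀ p ∈ Z, eval p.coords f = 0},
        fun f hf => hf.1, ?_⟩
      ext p
      constructor
      · rintro hp f ⟨-, Z, hZ, hf⟩
        exact hf p (hp Z hZ)
      · intro hp Z hZ
        obtain ⟨S, hS, rfl⟩ := hA hZ
        exact fun f hf => hp f ⟨hS f hf, _, hZ, fun q hq => hq f hf⟩)
    (by
      rintro _ ⟨S, hS, rfl⟩ _ ⟨T, hT, rfl⟩
      refine ⟨{h | ∃ f ∈ S, ∃ g ∈ T, h = f * g}, ?_, ?_⟩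
      · rintro _ ⟨f, hf, g, hg, rfl⟩
        obtain ⟨a, ha⟩ := hS f hf
        obtain ⟨b, hb⟩ := hT g hg
        exact ⟨a + b, ha.mul hb⟩
      · ext p
        constructor
        · rintro (hp | hp) _ ⟨f, hf, g, hg, rfl⟩
          · simp [hp f hf]
          · simp [hp g hg]
        · intro hp
          by_contra hcon
          rw [Set.mem_union, not_or] at hcon
          obtain ⟨h1, h2⟩ := hcon
          simp only [vanishingSet, Set.mem_ofPred_eq, not_forall] at h1 h2
          obtain ⟨f, hf, hf0⟩ := h1
          obtain ⟨g, hg, hg0⟩ := h2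
          have := hp _ ⟨f, hf, g, hg, rfl⟩
          rw [map_mul] at this
          exact (mul_ne_zero hf0 hg0) this)

theorem isClosed_iff {k : Type*} [Field k] {m : ℕ} {Z : Set (ProjSpace k m)} :
    IsClosed Z ↔ ∃ S : Set (MvPolynomial (Fin (m + 1)) k),
      (∀ f ∈ S, ∃ n, f.IsHomogeneous n) ∧ Z = vanishingSet S := by
  rw [← isOpen_compl_iff]
  change Zᶜᶜ ∈ {Z : Set (ProjSpace k m) | ∃ S : Set (MvPolynomial (Fin (m + 1)) k),
      (∀ f ∈ S, ∃ n, f.IsHomogeneous n) ∧ Z = vanishingSet S} ↔ _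
  rw [compl_compl]
  rfl

/-- The homogeneous ideal `I(Z)` of a subset `Z` of `ℙ^m`: the ideal generated by the homogeneous
polynomials that vanish at every point of `Z`. -/
noncomputable def vanishingIdeal {k : Type*} [Field k] {m : ℕ} (Z : Set (ProjSpace k m)) :
    Ideal (MvPolynomial (Fin (m + 1)) k) :=
  Ideal.span {f | (∃ n, f.IsHomogeneous n) ∧ ∀ p ∈ Z, eval p.coords f = 0}

theorem eval_eq_zero_of_mem_vanishingIdeal {k : Type*} [Field k] {m : ℕ}
    {Z : Set (ProjSpace k m)} {f : MvPolynomial (Fin (m + 1)) k} (hf : f ∈ vanishingIdeal Z)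
    {p : ProjSpace k m} (hp : p ∈ Z) : eval p.coords f = 0 := by
  have h : vanishingIdeal Z ≤ RingHom.ker (eval p.coords) :=
    Ideal.span_le.2 fun g hg => hg.2 p hp
  exact h hf

theorem subset_of_vanishingIdeal_le {k : Type*} [Field k] {m : ℕ} {Y Z : Set (ProjSpace k m)}
    (hZ : IsClosed Z) (h : vanishingIdeal Z ≤ vanishingIdeal Y) : Y ⊆ Z := by
  obtain ⟨S, hS, rfl⟩ := isClosed_iff.1 hZ
  intro p hp f hf
  exact eval_eq_zero_of_mem_vanishingIdeal
    (h (Ideal.subset_span ⟨hS f hf, fun q hq => hq f hf⟩)) hp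

instance noetherianSpace (k : Type*) [Field k] (m : ℕ) :
    TopologicalSpace.NoetherianSpace (ProjSpace k m) := by
  rw [((TopologicalSpace.noetherianSpace_TFAE (ProjSpace k m)).out 0 1 :)]
  have hanti : StrictAnti
      (fun Z : TopologicalSpace.Closeds (ProjSpace k m) => vanishingIdeal (Z : Set (ProjSpace k m))) := by
    intro Y Z hYZ
    refine lt_of_le_of_ne (Ideal.span_mono fun f hf => ⟨hf.1, fun p hp => hf.2 p (hYZ.le hp)⟩) ?_
    intro heq
    exact hYZ.not_ge (subset_of_vanishingIdeal_le Y.isClosed heq.ge)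
  exact hanti.wellFoundedLT

/-- The irreducible components of a subset `X` of `ℙ^m` in its Zariski topology, as subsets of
`ℙ^m`. -/
def components {k : Type*} [Field k] {m : ℕ} (X : Set (ProjSpace k m)) :
    Set (Set (ProjSpace k m)) :=
  (fun W : Set X => Subtype.val '' W) '' irreducibleComponents X

theorem finite_components {k : Type*} [Field k] {m : ℕ} (X : Set (ProjSpace k m)) :
    (components X).Finite :=
  TopologicalSpace.NoetherianSpace.finite_irreducibleComponents.image _

/-- The Hilbert function of `Z`: its value at `t` is the dimension of the degree `t` part of the
homogeneous coordinate ring `k[x_0, …, x_m] ⧸ I(Z)`. -/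
noncomputable def hilbertFunction {k : Type*} [Field k] {m : ℕ} (Z : Set (ProjSpace k m))
    (t : ℕ) : ℕ :=
  Module.finrank k
    ((homogeneousSubmodule (Fin (m + 1)) k t).map
      (Ideal.Quotient.mkₐ k (vanishingIdeal Z)).toLinearMap)

open Classical in
/-- The Hilbert polynomial of `Z`: the unique rational polynomial that agrees with the Hilbert
function at all large integers. (By Hilbert's theorem it exists.) -/
noncomputable def hilbertPolynomial {k : Type*} [Field k] {m : ℕ} (Z : Set (ProjSpace k m)) :
    Polynomial ℚ :=
  if h : ∃ P : Polynomial ℚ, ∀ᶠ t : ℕ in Filter.atTop,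
      (hilbertFunction Z t : ℚ) = P.eval (t : ℚ) then h.choose else 0

/-- The degree of a projective variety `Z`: the leading coefficient of its Hilbert polynomial
times the factorial of the degree of that polynomial. -/
noncomputable def degree {k : Type*} [Field k] {m : ℕ} (Z : Set (ProjSpace k m)) : ℚ :=
  (hilbertPolynomial Z).natDegree.factorial * (hilbertPolynomial Z).leadingCoeff

/-- `degInDim i X` is the sum of the degrees of the irreducible components of `X` of dimension
`i`, the dimension being the Krull dimension of the Zariski topology. The sum is finite by
`finite_components`. -/
noncomputable def degInDim {k : Type*} [Field k] {m : ℕ} (i : ℕ) (X : Set (ProjSpace k m)) : ℚ :=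
  ∑ᶠ Z ∈ {Z ∈ components X | topologicalKrullDim Z = i}, degree Z

end ProjSpace

/-!
Put `n = m - l`, and let `J` be the ideal of the union of the components `Z` of `X` that have
dimension `n`. Suppose that the degrees of these components add up to more than `c`.

By Noether normalization there are linear forms `y_0, …, y_n` over whose polynomial ring `A` the
coordinate ring `S ⧸ J` is finite (`exists_linear_noether_normalization`), and then so is every
`S ⧸ I(Z)`, which contains `A` for reasons of dimension. The growth of the Hilbert function shows
that the degree of `Z` is the rank of `S ⧸ I(Z)` over `A`
(`ProjSpace.exists_indepMod_and_degree_le`), and ranks add up over the components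
(`exists_indepMod_iInf`). So `S ⧸ J` contains `c + 1` elements that are linearly independent over `A`
(`ProjSpace.exists_indepMod_of_lt_degInDim`).

The point of the argument is that such elements can be found in low degrees: there are `c + 1`
independent monomials of degrees at most `0, 1, …, c` (`exists_linearIndependent_monomial`). Indeed,
over the fraction field of `A`, if the span of some monomials, `1` among them, contains all their
products with the variables, then it is everything. The free `A`-module on these monomials lies in
`S ⧸ J`, so that the Hilbert function of `X` at `d` is at least the sum of `C(n + d - j, n)` over
`0 ≤ j ≤ c` (`IndepMod.sum_choose_le`), the value for a hypersurface of degree `c + 1` in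
`ℙ^(n + 1)`. On the other hand it is at most `C(m + d, d) - r`, because `F_1, …, F_r` vanish on `X`,
and this is too small by hypothesis.

The dimension of a component is the Krull dimension of its topology. It is compared with that of
the coordinate ring by `ProjSpace.topologicalKrullDim_add_one_le` (adding the irrelevant ideal to a
chain) and with the number of linear forms by `ProjSpace.le_topologicalKrullDim` (going up for
homogeneous primes, and the homogeneous Nullstellensatz).
-/

attribute [local instance] MvPolynomial.gradedAlgebra

/-! ### Homogeneous polynomials and linear forms -/

section LinearForms

variable {k σ τ ι : Type*} [Field k]

theorem MvPolynomial.homogeneousComponent_mul_of_isHomogeneous {f b : MvPolynomial σ k} {e : ℕ}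
    (hb : b.IsHomogeneous e) (n : ℕ) :
    homogeneousComponent (n + e) (f * b) = homogeneousComponent n f * b := by
  conv_lhs => rw [← sum_homogeneousComponent f, Finset.sum_mul, map_sum]
  have h : ∀ i, homogeneousComponent (n + e) (homogeneousComponent i f * b)
      = if i = n then homogeneousComponent n f * b else 0 := by
    intro i
    rw [homogeneousComponent_of_mem
      ((mem_homogeneousSubmodule _ _).2 ((homogeneousComponent_isHomogeneous i f).mul hb))]
    by_cases hi : i = n
    · simp [hi]
    · rw [if_neg (by omega), if_neg hi]
  simp only [h, Finset.sum_ite_eq', Finset.mem_range]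
  split_ifs with hn
  · rfl
  · rw [homogeneousComponent_eq_zero _ _ (by omega), zero_mul]

theorem MvPolynomial.homogeneousComponent_mul_eq_zero_of_lt {f b : MvPolynomial σ k} {e n : ℕ}
    (hb : b.IsHomogeneous e) (hn : n < e) : homogeneousComponent n (f * b) = 0 := by
  rw [← sum_homogeneousComponent f, Finset.sum_mul, map_sum]
  refine Finset.sum_eq_zero fun i _ => ?_
  rw [homogeneousComponent_of_mem
    ((mem_homogeneousSubmodule _ _).2 ((homogeneousComponent_isHomogeneous i f).mul hb)),
    if_neg (by omega)]

/-- Substituting linear forms for the variables preserves degrees, so it commutes with taking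
homogeneous components. -/
theorem MvPolynomial.homogeneousComponent_aeval {y : τ → MvPolynomial σ k}
    (hy : ∀ i, (y i).IsHomogeneous 1) (n : ℕ) (f : MvPolynomial τ k) :
    homogeneousComponent n (aeval y f) = aeval y (homogeneousComponent n f) := by
  conv_lhs => rw [← sum_homogeneousComponent f, map_sum, map_sum]
  have h : ∀ i, homogeneousComponent n (aeval y (homogeneousComponent i f))
      = if i = n then aeval y (homogeneousComponent n f) else 0 := by
    intro i
    have := (homogeneousComponent_isHomogeneous i f).aeval y hy
    rw [one_mul] at this
    rw [homogeneousComponent_of_mem ((mem_homogeneousSubmodule _ _).2 this)]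
    by_cases hi : i = n
    · simp [hi]
    · rw [if_neg (Ne.symm hi), if_neg hi]
  simp only [h, Finset.sum_ite_eq', Finset.mem_range]
  split_ifs with hn
  · rfl
  · rw [homogeneousComponent_eq_zero _ _ (by omega), map_zero]

theorem MvPolynomial.isHomogeneous_aeval {y : τ → MvPolynomial σ k}
    (hy : ∀ i, (y i).IsHomogeneous 1) {n : ℕ} {f : MvPolynomial τ k} (hf : f.IsHomogeneous n) :
    (aeval y f).IsHomogeneous n := by
  simpa using IsHomogeneous.aeval hf y hy

end LinearForms

/-! ### Independence modulo an ideal and Hilbert functions -/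

section HilbertFunction

variable {k σ τ ι : Type*} [Field k]

/-- The family `b` is linearly independent, modulo the ideal `I`, over the ring of polynomials in
the elements `y`: no nontrivial combination of the `b i` whose coefficients are polynomials in the
`y j` lies in `I`. -/
def IndepMod [Fintype ι] (I : Ideal (MvPolynomial σ k)) (y : τ → MvPolynomial σ k)
    (b : ι → MvPolynomial σ k) : Prop :=
  ∀ a : ι → MvPolynomial τ k, ∑ i, aeval y (a i) * b i ∈ I → a = 0

/-- Evaluation at the elements `y` modulo the ideal `I`, as a ring homomorphism. -/
noncomputable def evalMod (I : Ideal (MvPolynomial σ k)) (y : τ → MvPolynomial σ k) :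
    MvPolynomial τ k →+* MvPolynomial σ k ⧸ I :=
  (Ideal.Quotient.mk I).comp (aeval y : MvPolynomial τ k →ₐ[k] MvPolynomial σ k).toRingHom

theorem evalMod_apply (I : Ideal (MvPolynomial σ k)) (y : τ → MvPolynomial σ k)
    (f : MvPolynomial τ k) : evalMod I y f = Ideal.Quotient.mk I (aeval y f) :=
  rfl

theorem evalMod_eq_zero_iff {I : Ideal (MvPolynomial σ k)} {y : τ → MvPolynomial σ k}
    {f : MvPolynomial τ k} : evalMod I y f = 0 ↔ aeval y f ∈ I :=
  Ideal.Quotient.eq_zero_iff_mem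

theorem evalMod_injective_iff {I : Ideal (MvPolynomial σ k)} {y : τ → MvPolynomial σ k} :
    Function.Injective (evalMod I y) ↔ ∀ f, aeval (R := k) y f ∈ I → f = 0 := by
  simp only [injective_iff_map_eq_zero, evalMod_eq_zero_iff]

/-- The degree `t` part of the quotient of the polynomial ring by the ideal `I`. -/
noncomputable def degreePart (I : Ideal (MvPolynomial σ k)) (t : ℕ) :
    Submodule k (MvPolynomial σ k ⧸ I) :=
  (homogeneousSubmodule σ k t).map (Ideal.Quotient.mkₐ k I).toLinearMap

theorem mk_mem_degreePart {I : Ideal (MvPolynomial σ k)} {t : ℕ} {f : MvPolynomial σ k}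
    (hf : f.IsHomogeneous t) : Ideal.Quotient.mk I f ∈ degreePart I t :=
  ⟨f, hf, rfl⟩

instance finite_homogeneousSubmodule [Finite σ] (t : ℕ) :
    Module.Finite k (homogeneousSubmodule σ k t) :=
  Module.Finite.iff_fg.2 (homogeneousSubmodule_fg (R := k) (σ := σ) t)

instance finite_degreePart [Finite σ] (I : Ideal (MvPolynomial σ k)) (t : ℕ) :
    Module.Finite k (degreePart I t) :=
  inferInstanceAs (Module.Finite k ((homogeneousSubmodule σ k t).map _))

theorem card_finsuppAntidiag_fin (n t : ℕ) :
    (Finset.finsuppAntidiag (Finset.univ : Finset (Fin (n + 1))) t).card = (n + t).choose n := by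
  rw [Finset.card_finsuppAntidiag_nat_eq_choose, Finset.card_univ, Fintype.card_fin,
    show n + 1 + t - 1 = n + t by omega, Nat.choose_symm_add]

theorem mem_finsuppAntidiag_univ_iff {n t : ℕ} {u : Fin n →₀ ℕ} :
    u ∈ Finset.finsuppAntidiag (Finset.univ : Finset (Fin n)) t ↔ u.degree = t := by
  rw [Finset.mem_finsuppAntidiag, Finsupp.degree_eq_sum]
  simp

theorem finrank_homogeneousSubmodule_fin (n t : ℕ) :
    Module.finrank k (homogeneousSubmodule (Fin (n + 1)) k t) = (n + t).choose n := by
  rw [homogeneousSubmodule_eq_finsupp_supported]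
  have e := AddMonoidAlgebra.supportedEquivFinsupp (R := k) (S := k)
    {d : Fin (n + 1) →₀ ℕ | d.degree = t}
  have hs : {d : Fin (n + 1) →₀ ℕ | d.degree = t}
      = ↑(Finset.finsuppAntidiag (Finset.univ : Finset (Fin (n + 1))) t) := by
    ext u
    rw [Finset.mem_coe, mem_finsuppAntidiag_univ_iff, Set.mem_ofPred_eq]
  rw [LinearEquiv.finrank_eq e, hs]
  rw [Module.finrank_finsupp_self]
  simp [card_finsuppAntidiag_fin]

/-- A family of homogeneous elements independent over `k[y_0, …, y_n]` modulo `I` bounds the Hilbert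
function of `I` from below, by the Hilbert function of the free module on the family. -/
theorem sum_choose_le_finrank_degreePart [Finite σ] [Fintype ι] {I : Ideal (MvPolynomial σ k)}
    {n : ℕ} {y : Fin (n + 1) → MvPolynomial σ k} (hy : ∀ i, (y i).IsHomogeneous 1)
    {b : ι → MvPolynomial σ k} (hI : IndepMod I y b) {δ : ι → ℕ}
    (hb : ∀ i, (b i).IsHomogeneous (δ i)) {t : ℕ} (ht : ∀ i, δ i ≤ t) :
    ∑ i, (n + (t - δ i)).choose n ≤ Module.finrank k (degreePart I t) := by
  classical
  let T : ι → Finset (Fin (n + 1) →₀ ℕ) := fun i => Finset.finsuppAntidiag Finset.univ (t - δ i)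
  let v : (Σ i, T i) → degreePart I t := fun x =>
    ⟨Ideal.Quotient.mk I (aeval y (monomial x.2.1 (1 : k)) * b x.1), by
      have h1 : (monomial x.2.1 (1 : k)).IsHomogeneous (t - δ x.1) :=
        isHomogeneous_monomial _ (mem_finsuppAntidiag_univ_iff.1 x.2.2)
      have h2 := (isHomogeneous_aeval hy h1).mul (hb x.1)
      rw [Nat.sub_add_cancel (ht x.1)] at h2
      exact mk_mem_degreePart h2⟩
  have hv : LinearIndependent k v := by
    rw [Fintype.linearIndependent_iff]
    intro g hg x
    have h0 : ∑ i, aeval y (∑ u : T i, monomial u.1 (g ⟨i, u⟩)) * b i ∈ I := by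
      rw [← Ideal.Quotient.eq_zero_iff_mem]
      have h1 := congrArg Subtype.val hg
      rw [Submodule.coe_sum, Fintype.sum_sigma] at h1
      rw [map_sum]
      refine Eq.trans (Finset.sum_congr rfl fun i _ => ?_) h1
      rw [map_sum, Finset.sum_mul, map_sum]
      refine Finset.sum_congr rfl fun u _ => ?_
      have h2 : (monomial u.1 (g ⟨i, u⟩) : MvPolynomial (Fin (n + 1)) k)
          = g ⟨i, u⟩ • monomial u.1 1 := by
        rw [smul_monomial, smul_eq_mul, mul_one]
      rw [h2, map_smul, smul_mul_assoc]
      rfl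
    have h3 := congrArg (coeff x.2.1) (congrFun (hI _ h0) x.1)
    rw [coeff_sum, Pi.zero_apply, coeff_zero, Finset.sum_eq_single x.2] at h3
    · simpa using h3
    · intro u _ hu
      rw [coeff_monomial, if_neg (fun h => hu (Subtype.ext h))]
    · simp
  have := hv.fintype_card_le_finrank
  rw [Fintype.card_sigma] at this
  refine le_trans (le_of_eq (Finset.sum_congr rfl fun i _ => ?_)) this
  rw [Fintype.card_coe, card_finsuppAntidiag_fin]

end HilbertFunction

/-! ### Monomials of small degree that stay independent -/

/-- If an algebra `R` over a domain `A` is generated by the elements `x i` and contains `c + 1`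
elements that are linearly independent over `A`, then it contains `c + 1` linearly independent
monomials in the `x i`, the `j`-th of them of degree at most `j`. Indeed, over the fraction field,
as long as the span of the monomials already found is not everything, it is not stable under
multiplication by all the `x i`, so that a monomial of the next degree lies outside it. -/
theorem exists_linearIndependent_monomial {A R σ : Type*} [CommRing A] [IsDomain A] [CommRing R]
    [Algebra A R] {x : σ → R} (hx : Algebra.adjoin A (Set.range x) = ⊤) {c : ℕ}
    {v : Fin (c + 1) → R} (hv : LinearIndependent A v) :
    ∃ u : Fin (c + 1) → σ →₀ ℕ, (∀ j, (u j).degree ≤ j) ∧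
      LinearIndependent A (fun j => (u j).prod fun i e => x i ^ e) := by
  let F := FractionRing A
  let Q := TensorProduct A F R
  let g : R →ₐ[A] Q := Algebra.TensorProduct.includeRight
  let μ : (σ →₀ ℕ) → R := fun u => u.prod fun i e => x i ^ e
  have hvQ : LinearIndependent F (g ∘ v) := Module.Flat.linearIndependent_one_tmul hv
  have key : ∀ j ≤ c, ∃ u : Fin (j + 1) → σ →₀ ℕ, (∀ i, (u i).degree ≤ i) ∧ u 0 = 0 ∧
      LinearIndependent F (fun i => g (μ (u i))) := by
    intro j
    induction j with
    | zero =>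
      intro _
      refine ⟨fun _ => 0, by simp, rfl, ?_⟩
      have hQ : Nontrivial Q := ⟨_, _, hvQ.ne_zero 0⟩
      have : Unique (Fin (0 + 1)) := inferInstanceAs (Unique (Fin 1))
      rw [linearIndependent_unique_iff]
      simp [μ]
    | succ j ih =>
      intro hj
      obtain ⟨u, hu, hu0, hli⟩ := ih (by omega)
      let U := Submodule.span F (Set.range fun i => g (μ (u i)))
      obtain ⟨w, hw, hwU⟩ : ∃ w : σ →₀ ℕ, w.degree ≤ j + 1 ∧ g (μ w) ∉ U := by
        by_contra! hcon
        have hone : (1 : Q) ∈ U := by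
          refine Submodule.subset_span ⟨0, ?_⟩
          simp [hu0, μ]
        have hstab : ∀ i, ∀ q ∈ U, g (x i) * q ∈ U := by
          intro i q hq
          have hle : U ≤ U.comap (LinearMap.mulLeft F (g (x i))) := by
            refine Submodule.span_le.2 ?_
            rintro _ ⟨l, rfl⟩
            have h1 : g (x i) * g (μ (u l)) = g (μ (Finsupp.single i 1 + u l)) := by
              rw [← map_mul]
              congr 1
              simp only [μ]
              rw [Finsupp.prod_add_index' (by simp) (by simp [pow_add]),
                Finsupp.prod_single_index (by simp), pow_one]
            change g (x i) * g (μ (u l)) ∈ U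
            rw [h1]
            refine hcon _ ?_
            rw [map_add, Finsupp.degree_single]
            have := hu l
            omega
          exact hle hq
        have hall : ∀ r : R, ∀ q ∈ U, g r * q ∈ U := by
          intro r
          have hr : r ∈ Algebra.adjoin A (Set.range x) := hx ▸ Algebra.mem_top
          induction hr using Algebra.adjoin_induction with
          | mem r hr =>
            obtain ⟨i, rfl⟩ := hr
            exact hstab i
          | algebraMap a =>
            intro q hq
            rw [AlgHom.commutes, ← Algebra.smul_def, ← algebraMap_smul F]
            exact U.smul_mem _ hq
          | add r s _ _ hr hs =>
            intro q hq
            rw [map_add, add_mul]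
            exact U.add_mem (hr q hq) (hs q hq)
          | mul r s _ _ hr hs =>
            intro q hq
            rw [map_mul, mul_assoc]
            exact hr _ (hs q hq)
        have hvU : ∀ i, g (v i) ∈ U := fun i => by simpa using hall (v i) 1 hone
        have hfin : Module.Finite F U := Module.Finite.span_of_finite F (Set.finite_range _)
        have hv2 : LinearIndependent F (fun i => (⟨g (v i), hvU i⟩ : U)) :=
          LinearIndependent.of_comp U.subtype hvQ
        have h1 := hv2.fintype_card_le_finrank
        have h2 : Module.finrank F U ≤ Fintype.card (Fin (j + 1)) := finrank_range_le_card _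
        rw [Fintype.card_fin] at h1 h2
        omega
      refine ⟨Fin.snoc u w, ?_, ?_, ?_⟩
      · intro i
        refine Fin.lastCases ?_ (fun i => ?_) i
        · simpa using hw
        · simpa using hu i
      · rw [← Fin.castSucc_zero, Fin.snoc_castSucc, hu0]
      · have h := linearIndependent_finSnoc.2 ⟨hli, hwU⟩
        convert! h using 1
        ext i
        refine Fin.lastCases ?_ (fun i => ?_) i <;> simp
  obtain ⟨u, hu, -, hli⟩ := key c le_rfl
  exact ⟨u, hu, LinearIndependent.of_comp g.toLinearMap (hli.restrict_scalars' A)⟩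

/-- A reformulation of `exists_linearIndependent_monomial` for an algebra that is given by a ring
homomorphism `φ`. -/
theorem exists_independent_monomial {A R σ : Type*} [CommRing A] [IsDomain A] [CommRing R]
    (φ : A →+* R) {x : σ → R}
    (hx : Subring.closure (Set.range φ ∪ Set.range x) = ⊤) {c : ℕ} {v : Fin (c + 1) → R}
    (hv : ∀ a : Fin (c + 1) → A, ∑ i, φ (a i) * v i = 0 → a = 0) :
    ∃ u : Fin (c + 1) → σ →₀ ℕ, (∀ j, (u j).degree ≤ j) ∧
      ∀ a : Fin (c + 1) → A, ∑ j, φ (a j) * ((u j).prod fun i e => x i ^ e) = 0 → a = 0 := by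
  let : Algebra A R := φ.toAlgebra
  have hx' : Algebra.adjoin A (Set.range x) = ⊤ := by
    rw [eq_top_iff]
    intro r _
    have hr : r ∈ Subring.closure (Set.range φ ∪ Set.range x) := hx ▸ Subring.mem_top r
    have hle : Subring.closure (Set.range φ ∪ Set.range x)
        ≤ (Algebra.adjoin A (Set.range x)).toSubring := by
      rw [Subring.closure_le]
      rintro _ (⟨a, rfl⟩ | ⟨i, rfl⟩)
      · exact Subalgebra.algebraMap_mem (Algebra.adjoin A (Set.range x)) a
      · exact Algebra.subset_adjoin ⟨i, rfl⟩
    exact hle hr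
  obtain ⟨u, hu, hli⟩ := exists_linearIndependent_monomial hx' (v := v) (by
    rw [Fintype.linearIndependent_iff]
    exact fun a ha => congrFun (hv a ha))
  rw [Fintype.linearIndependent_iff] at hli
  exact ⟨u, hu, fun a ha => funext (hli a ha)⟩

/-- A family of `c + 1` elements that is independent modulo `I` over the polynomials in `y` can be
replaced by one of monomials of degrees at most `0, 1, …, c`. -/
theorem IndepMod.exists_monomial {k σ τ : Type*} [Field k] {I : Ideal (MvPolynomial σ k)}
    {y : τ → MvPolynomial σ k} {c : ℕ} {v : Fin (c + 1) → MvPolynomial σ k} (hv : IndepMod I y v) :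
    ∃ u : Fin (c + 1) → σ →₀ ℕ, (∀ j, (u j).degree ≤ j) ∧
      IndepMod I y (fun j => monomial (u j) 1) := by
  have hx : Subring.closure (Set.range (evalMod I y) ∪
      Set.range fun i => Ideal.Quotient.mk I (X i : MvPolynomial σ k)) = ⊤ := by
    rw [eq_top_iff]
    intro r _
    obtain ⟨f, rfl⟩ := Ideal.Quotient.mk_surjective r
    induction f using MvPolynomial.induction_on with
    | C a =>
      refine Subring.subset_closure (Or.inl ⟨C a, ?_⟩)
      rw [evalMod_apply, aeval_C]
      rfl
    | add p q hp hq =>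
      rw [map_add]
      exact add_mem (hp trivial) (hq trivial)
    | mul_X p i hp =>
      rw [map_mul]
      exact mul_mem (hp trivial) (Subring.subset_closure (Or.inr ⟨i, rfl⟩))
  obtain ⟨u, hu, hli⟩ := exists_independent_monomial (evalMod I y) hx (v := fun i => Ideal.Quotient.mk I (v i))
    (fun a ha => hv a (by
      rw [← Ideal.Quotient.eq_zero_iff_mem, map_sum]
      simpa only [map_mul, evalMod_apply] using ha))
  refine ⟨u, hu, fun a ha => hli a ?_⟩
  rw [← Ideal.Quotient.eq_zero_iff_mem, map_sum] at ha
  rw [← ha]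
  refine Finset.sum_congr rfl fun j _ => ?_
  dsimp only
  rw [map_mul, evalMod_apply, monomial_eq, C_1, one_mul, map_finsuppProd]
  simp only [map_pow]

/-! ### Noether normalization by linear forms -/

theorem RingHom.IsIntegral.of_forall_isIntegralElem {A B R : Type*} [CommRing A] [CommRing B]
    [CommRing R] {φ : A →+* R} (hφ : φ.IsIntegral) {ψ : B →+* R}
    (h : ∀ f, ψ.IsIntegralElem (φ f)) : ψ.IsIntegral := by
  let : Algebra B R := ψ.toAlgebra
  let φ' : A →+* integralClosure B R := φ.codRestrict (integralClosure B R) h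
  have hg : (algebraMap (integralClosure B R) R).IsIntegral :=
    RingHom.IsIntegral.tower_top φ' _ hφ
  have : Algebra.IsIntegral (integralClosure B R) R := ⟨hg⟩
  exact fun r => isIntegral_trans r (hg r)

section

variable {k σ τ : Type*} [Field k]

theorem evalMod_isIntegral_of_le {p q : Ideal (MvPolynomial σ k)} (hpq : p ≤ q)
    {y : τ → MvPolynomial σ k} (hint : (evalMod p y).IsIntegral) : (evalMod q y).IsIntegral := by
  have h : evalMod q y = (Ideal.Quotient.factor hpq).comp (evalMod p y) := by
    ext f <;> rfl
  rw [h]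
  exact hint.trans _ _ (RingHom.isIntegral_of_surjective _ (Ideal.Quotient.factor_surjective hpq))

/-- Along a line `P + T a`, a homogeneous polynomial `G` of degree `e` is a polynomial in `T` of
degree at most `e`, and its coefficient at `T ^ e` is `G(a)`. -/
theorem coeff_aeval_line {B : Type*} [CommRing B] [Algebra k B] {e : ℕ}
    {G : MvPolynomial τ k} (hG : G.IsHomogeneous e) (P : τ → B) (a : τ → k) :
    (aeval (fun i => Polynomial.C (P i) + Polynomial.C (algebraMap k B (a i)) * Polynomial.X)
      G).natDegree ≤ e ∧
    (aeval (fun i => Polynomial.C (P i) + Polynomial.C (algebraMap k B (a i)) * Polynomial.X)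
      G).coeff e = algebraMap k B (eval a G) := by
  set z : τ → Polynomial B :=
    fun i => Polynomial.C (P i) + Polynomial.C (algebraMap k B (a i)) * Polynomial.X with hz
  have hmon : ∀ u : τ →₀ ℕ, (u.prod fun i s => z i ^ s).natDegree ≤ u.degree ∧
      (u.prod fun i s => z i ^ s).coeff u.degree = algebraMap k B (u.prod fun i s => a i ^ s) := by
    intro u
    induction u using Finsupp.induction_linear with
    | zero => simp
    | add u v hu hv =>
      rw [Finsupp.prod_add_index' (by simp) (by simp [pow_add]),
        Finsupp.prod_add_index' (by simp) (by simp [pow_add]), map_add, map_mul]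
      exact ⟨Polynomial.natDegree_mul_le_of_le hu.1 hv.1, by
        rw [Polynomial.coeff_mul_add_eq_of_natDegree_le hu.1 hv.1, hu.2, hv.2]⟩
    | single i s =>
      rw [Finsupp.prod_single_index (by simp), Finsupp.prod_single_index (by simp),
        Finsupp.degree_single]
      have h1 : (z i).natDegree ≤ 1 := by
        exact Polynomial.natDegree_add_le_of_degree_le (by simp)
          ((Polynomial.natDegree_C_mul_le _ _).trans Polynomial.natDegree_X_le)
      refine ⟨by simpa using Polynomial.natDegree_pow_le_of_le s h1, ?_⟩
      have h2 := Polynomial.coeff_pow_of_natDegree_le (m := s) h1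
      rw [mul_one] at h2
      rw [h2, map_pow]
      simp [hz]
  have hdeg : ∀ u ∈ G.support, u.degree = e := fun u hu => hG.degree_eq_sum_deg_support hu ▸ rfl
  have hexp : aeval z G = ∑ u ∈ G.support,
      algebraMap k (Polynomial B) (coeff u G) * u.prod fun i s => z i ^ s := by
    conv_lhs => rw [G.as_sum, map_sum]
    simp only [aeval_monomial]
  have halg : ∀ r : k, algebraMap k (Polynomial B) r = Polynomial.C (algebraMap k B r) :=
    fun r => rfl
  rw [hexp]
  constructor
  · refine Polynomial.natDegree_sum_le_of_forall_le _ _ fun u hu => ?_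
    rw [halg, ← hdeg u hu]
    exact (Polynomial.natDegree_C_mul_le _ _).trans (hmon u).1
  · rw [Polynomial.finsetSum_coeff, eval_eq, map_sum]
    refine Finset.sum_congr rfl fun u hu => ?_
    rw [halg, Polynomial.coeff_C_mul, ← hdeg u hu, (hmon u).2, map_mul]
    rfl

/-- If `S ⧸ J` is integral over the polynomials in `n` linear forms, but these are not independent
modulo `J`, then `n - 1` linear forms suffice: project from a point at which a homogeneous
relation between the given forms does not vanish. -/
theorem exists_linear_forms_of_not_injective [Infinite k] {J : Ideal (MvPolynomial σ k)}
    (hJ : J.IsHomogeneous (homogeneousSubmodule σ k)) (hJ1 : J ≠ ⊤) {n : ℕ}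
    {y : Fin n → MvPolynomial σ k} (hy : ∀ i, (y i).IsHomogeneous 1)
    (hint : (evalMod J y).IsIntegral) (hinj : ¬ Function.Injective (evalMod J y)) :
    ∃ n' < n, ∃ y' : Fin n' → MvPolynomial σ k, (∀ i, (y' i).IsHomogeneous 1) ∧
      (evalMod J y').IsIntegral := by
  obtain ⟨G, e, hG, hGJ, hG0⟩ : ∃ (G : MvPolynomial (Fin n) k) (e : ℕ), G.IsHomogeneous e ∧
      aeval y G ∈ J ∧ G ≠ 0 := by
    rw [evalMod_injective_iff] at hinj
    push Not at hinj
    obtain ⟨f, hf, hf0⟩ := hinj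
    obtain ⟨e, he⟩ : ∃ e, homogeneousComponent e f ≠ 0 := by
      by_contra! h
      refine hf0 ?_
      rw [← sum_homogeneousComponent f]
      exact Finset.sum_eq_zero fun i _ => h i
    refine ⟨_, e, homogeneousComponent_isHomogeneous e f, ?_, he⟩
    rw [← homogeneousComponent_aeval hy]
    exact homogeneousComponent_mem_of_mem hJ hf e
  obtain ⟨a, ha⟩ : ∃ a, eval a G ≠ 0 := by
    by_contra! h
    exact hG0 (MvPolynomial.funext fun r => by rw [h r, map_zero])
  obtain ⟨i₀, hi₀⟩ : ∃ i₀, a i₀ ≠ 0 := by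
    by_contra! h
    obtain rfl : a = 0 := _root_.funext h
    have he : e = 0 := by
      by_contra he
      have h1 := hG.coeff_eq_zero (d := 0) (by simpa using Ne.symm he)
      exact ha (by rw [← constantCoeff_eq] at h1; simpa using h1)
    rw [he, ← totalDegree_zero_iff_isHomogeneous] at hG
    rw [totalDegree_eq_zero_iff_eq_C.1 hG] at ha hGJ
    rw [eval_C] at ha
    rw [aeval_C] at hGJ
    exact hJ1 (Ideal.eq_top_of_isUnit_mem _ hGJ
      ((isUnit_iff_ne_zero.2 ha).map (algebraMap k (MvPolynomial σ k))))
  obtain ⟨n, rfl⟩ : ∃ n', n = n' + 1 := ⟨n - 1, by have := i₀.2; omega⟩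
  let z : MvPolynomial σ k := C (a i₀)⁻¹ * y i₀
  have hz : z.IsHomogeneous 1 := (hy i₀).C_mul _
  let y' : Fin n → MvPolynomial σ k := fun j => y (i₀.succAbove j) - C (a (i₀.succAbove j)) * z
  refine ⟨n, n.lt_succ_self, y', fun j => (hy _).sub (hz.C_mul _), ?_⟩
  let P : Fin (n + 1) → MvPolynomial (Fin n) k := i₀.insertNth 0 X
  have hP : ∀ i, y i = aeval y' (P i) + C (a i) * z := by
    intro i
    refine Fin.succAboveCases i₀ ?_ (fun j => ?_) i
    · simp only [P, Fin.insertNth_apply_same, map_zero, zero_add, z]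
      rw [← mul_assoc, ← C_mul, mul_inv_cancel₀ hi₀, C_1, one_mul]
    · simp only [P, Fin.insertNth_apply_succAbove, aeval_X, y']
      ring
  have hzint : (evalMod J y').IsIntegralElem (Ideal.Quotient.mk J z) := by
    obtain ⟨hd, hc⟩ := coeff_aeval_line hG P a
    set p := aeval (fun i => Polynomial.C (P i) +
      Polynomial.C (algebraMap k (MvPolynomial (Fin n) k) (a i)) * Polynomial.X) G with hp
    refine ⟨Polynomial.C (C (eval a G)⁻¹) * p, ?_, ?_⟩
    · refine Polynomial.monic_of_natDegree_le_of_coeff_eq_one e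
        ((Polynomial.natDegree_C_mul_le _ _).trans hd) ?_
      rw [Polynomial.coeff_C_mul, hc, algebraMap_eq, ← C_mul, inv_mul_cancel₀ ha, C_1]
    · rw [Polynomial.eval₂_mul]
      have h0 : Polynomial.eval₂ (evalMod J y') (Ideal.Quotient.mk J z) p = evalMod J y G := by
        have h1 : ((Polynomial.eval₂RingHom (evalMod J y') (Ideal.Quotient.mk J z)).comp
            (aeval (fun i => Polynomial.C (P i) +
              Polynomial.C (algebraMap k (MvPolynomial (Fin n) k) (a i)) * Polynomial.X) :
                MvPolynomial (Fin (n + 1)) k →ₐ[k] _).toRingHom) = evalMod J y := by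
          refine MvPolynomial.ringHom_ext (fun r => ?_) fun i => ?_
          · simp [evalMod_apply]
          · have := congrArg (Ideal.Quotient.mk J) (hP i)
            rw [map_add, map_mul] at this
            simp [evalMod_apply, this]
        exact congrArg (fun f => f G) h1
      rw [h0, evalMod_eq_zero_iff.2 hGJ, mul_zero]
  refine hint.of_forall_isIntegralElem fun f => ?_
  induction f using MvPolynomial.induction_on with
  | C r =>
    have : evalMod J y (C r) = evalMod J y' (C r) := by simp [evalMod_apply]
    rw [this]
    exact RingHom.isIntegralElem_map _
  | add p q hp hq =>
    rw [map_add]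
    exact hp.add _ hq
  | mul_X p i hp =>
    rw [map_mul]
    refine hp.mul _ ?_
    have : evalMod J y (X i) = evalMod J y' (P i) + evalMod J y' (C (a i)) *
        Ideal.Quotient.mk J z := by
      rw [evalMod_apply, aeval_X, hP i, map_add, map_mul]
      simp [evalMod_apply]
    rw [this]
    exact (RingHom.isIntegralElem_map _).add _ ((RingHom.isIntegralElem_map _).mul _ hzint)

/-- Graded Noether normalization: over an infinite field, the quotient by a proper homogeneous
ideal is integral over a polynomial ring in linear forms. -/
theorem exists_linear_noether_normalization [Infinite k] [Finite σ] {J : Ideal (MvPolynomial σ k)}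
    (hJ : J.IsHomogeneous (homogeneousSubmodule σ k)) (hJ1 : J ≠ ⊤) :
    ∃ (n : ℕ) (y : Fin n → MvPolynomial σ k), (∀ i, (y i).IsHomogeneous 1) ∧
      Function.Injective (evalMod J y) ∧ (evalMod J y).IsIntegral := by
  classical
  have hex : ∃ (n : ℕ) (y : Fin n → MvPolynomial σ k), (∀ i, (y i).IsHomogeneous 1) ∧
      (evalMod J y).IsIntegral := by
    obtain ⟨n, ⟨e⟩⟩ := Finite.exists_equiv_fin σ
    refine ⟨n, fun i => X (e.symm i), fun i => isHomogeneous_X _ _, fun r => ?_⟩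
    obtain ⟨f, rfl⟩ := Ideal.Quotient.mk_surjective r
    have : evalMod J (fun i => X (e.symm i)) (rename e f) = Ideal.Quotient.mk J f := by
      rw [evalMod_apply, aeval_rename]
      simp [Function.comp_def]
    rw [← this]
    exact RingHom.isIntegralElem_map _
  obtain ⟨y, hy, hint⟩ := Nat.find_spec hex
  refine ⟨_, y, hy, ?_, hint⟩
  by_contra hinj
  obtain ⟨n', hn', h⟩ := exists_linear_forms_of_not_injective hJ hJ1 hy hint hinj
  exact Nat.find_min hex hn' h

end

/-! ### The rank of a finite extension and the growth of the Hilbert function -/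

/-- If the elements `e i` generate a finite algebra `R` over a domain `A` as a module, then some of
them form a basis up to torsion: they are independent, and a nonzero multiple of every element of
`R` is a combination of them, with the same factor for all elements. -/
theorem exists_independent_and_smul_mem {A R ι : Type*} [CommRing A] [IsDomain A] [CommRing R]
    {φ : A →+* R} (hφ : φ.Finite) (e : ι → R)
    (he : ∀ M : AddSubgroup R, (∀ a, ∀ r ∈ M, φ a * r ∈ M) → (∀ i, e i ∈ M) → M = ⊤) :
    ∃ (ρ : ℕ) (i : Fin ρ → ι), (∀ g : Fin ρ → A, ∑ j, φ (g j) * e (i j) = 0 → g = 0) ∧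
      ∃ a ≠ 0, ∀ r, ∃ g : Fin ρ → A, φ a * r = ∑ j, φ (g j) * e (i j) := by
  classical
  let : Algebra A R := φ.toAlgebra
  have hfin : Module.Finite A R := hφ
  have hspan : Submodule.span A (Set.range e) = ⊤ := by
    have := he (Submodule.span A (Set.range e)).toAddSubgroup
      (fun a r hr => Submodule.smul_mem _ a hr) (fun i => Submodule.subset_span ⟨i, rfl⟩)
    rw [eq_top_iff]
    intro r _
    have hr : r ∈ (⊤ : AddSubgroup R) := trivial
    rw [← this] at hr
    exact hr
  obtain ⟨s, hs, hspan'⟩ := Submodule.fg_span_iff_fg_span_finset_subset (Set.range e) |>.1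
    (hspan ▸ hfin.fg_top)
  obtain ⟨T, hT, hmax⟩ := exists_maximal_linearIndepOn A (fun x : s => (x : R))
  have hfac : ∀ x : s, ∃ a : A, a ≠ 0 ∧ a • (x : R) ∈ Submodule.span A ((fun x : s => (x : R)) '' T) := by
    intro x
    by_cases hx : x ∈ T
    · exact ⟨1, one_ne_zero, by
        rw [one_smul]
        exact Submodule.subset_span ⟨x, hx, rfl⟩⟩
    · exact hmax x hx
  choose f hf0 hf using hfac
  have hsurj : ∀ x : s, ∃ i, e i = x := fun x => hs x.2
  choose i hi using hsurj
  let ε : Fin (Fintype.card T) ≃ T := (Fintype.equivFin T).symm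
  have hli : LinearIndependent A (fun x : T => (x.1 : R)) := hT
  have hrange : (fun x : s => (x : R)) '' T = Set.range (fun j => ((ε j).1 : R)) := by
    ext r
    constructor
    · rintro ⟨x, hx, rfl⟩
      exact ⟨ε.symm ⟨x, hx⟩, by simp⟩
    · rintro ⟨j, rfl⟩
      exact ⟨(ε j).1, (ε j).2, rfl⟩
  refine ⟨Fintype.card T, fun j => i (ε j).1, ?_, ∏ x, f x,
    Finset.prod_ne_zero_iff.2 fun x _ => hf0 x, ?_⟩
  · intro g hg
    simp only [hi] at hg
    have h2 := hli.comp ε ε.injective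
    rw [Fintype.linearIndependent_iff] at h2
    exact funext (h2 g hg)
  · have hall : ∀ r : R, (∏ x, f x) • r ∈ Submodule.span A (Set.range fun j => ((ε j).1 : R)) := by
      intro r
      have hr : r ∈ Submodule.span A (s : Set R) := by
        rw [← hspan', hspan]
        trivial
      induction hr using Submodule.span_induction with
      | mem x hx =>
        have h3 : (∏ x, f x) • x = (∏ z ∈ Finset.univ.erase ⟨x, hx⟩, f z) • f ⟨x, hx⟩ • x := by
          rw [smul_smul, Finset.prod_erase_mul _ _ (Finset.mem_univ _)]
        rw [h3, ← hrange]
        exact Submodule.smul_mem _ _ (hf ⟨x, hx⟩)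
      | zero => simp
      | add x y _ _ hx hy =>
        rw [smul_add]
        exact add_mem hx hy
      | smul a x _ hx =>
        rw [smul_comm]
        exact Submodule.smul_mem _ _ hx
    intro r
    obtain ⟨g, hg⟩ := (Submodule.mem_span_range_iff_exists_fun A).1 (hall r)
    refine ⟨g, ?_⟩
    simp only [hi]
    exact hg.symm

section

variable {k σ τ : Type*} [Field k]

theorem evalMod_finite [Finite σ] {I : Ideal (MvPolynomial σ k)} {y : τ → MvPolynomial σ k}
    (hint : (evalMod I y).IsIntegral) : (evalMod I y).Finite := by
  refine RingHom.IsIntegral.to_finite hint ?_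
  have h1 : (algebraMap k (MvPolynomial σ k ⧸ I)).FiniteType := by
    rw [RingHom.finiteType_algebraMap]
    infer_instance
  have h2 : (evalMod I y).comp (algebraMap k (MvPolynomial τ k))
      = algebraMap k (MvPolynomial σ k ⧸ I) := by
    ext r
    rw [RingHom.comp_apply, evalMod_apply, algebraMap_eq, aeval_C]
    rfl
  exact RingHom.FiniteType.of_comp_finiteType (h2 ▸ h1)

/-- For a homogeneous prime `p` such that `k[y_0, …, y_n] → S ⧸ p` is injective and integral, there
is a family of `ρ` homogeneous elements that is independent over `k[y]` modulo `p` (with `ρ` the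
rank of `S ⧸ p`), and multiplication by a nonzero homogeneous element of `k[y]` embeds `S ⧸ p` into
the free module on the family. -/
theorem exists_indepMod_and_finrank_degreePart_le [Finite σ] {p : Ideal (MvPolynomial σ k)}
    [hprime : p.IsPrime] (hp : p.IsHomogeneous (homogeneousSubmodule σ k)) {n : ℕ}
    {y : Fin (n + 1) → MvPolynomial σ k} (hy : ∀ i, (y i).IsHomogeneous 1)
    (hinj : Function.Injective (evalMod p y)) (hint : (evalMod p y).IsIntegral) :
    ∃ (ρ : ℕ) (b : Fin ρ → MvPolynomial σ k) (δ : Fin ρ → ℕ), (∀ j, (b j).IsHomogeneous (δ j)) ∧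
      IndepMod p y b ∧
      ∃ s, ∀ t, Module.finrank k (degreePart p t) ≤ ρ * (n + (t + s)).choose n := by
  classical
  obtain ⟨ρ, u, hu, a, ha0, ha⟩ := exists_independent_and_smul_mem (evalMod_finite hint)
    (fun u : σ →₀ ℕ => Ideal.Quotient.mk p (monomial u 1)) (by
      intro M hM he
      rw [eq_top_iff]
      intro r _
      obtain ⟨f, rfl⟩ := Ideal.Quotient.mk_surjective r
      induction f using MvPolynomial.induction_on' with
      | monomial u c =>
        have := hM (C c) _ (he u)
        rwa [evalMod_apply, aeval_C, algebraMap_eq, ← map_mul, C_mul_monomial, mul_one] at this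
      | add f g hf hg =>
        rw [map_add]
        exact add_mem (hf trivial) (hg trivial))
  let b : Fin ρ → MvPolynomial σ k := fun j => monomial (u j) 1
  let δ : Fin ρ → ℕ := fun j => (u j).degree
  have hb : ∀ j, (b j).IsHomogeneous (δ j) := fun j => isHomogeneous_monomial _ rfl
  obtain ⟨s, hs⟩ : ∃ s, homogeneousComponent s a ≠ 0 := by
    by_contra! h
    refine ha0 ?_
    rw [← sum_homogeneousComponent a]
    exact Finset.sum_eq_zero fun i _ => h i
  refine ⟨ρ, b, δ, hb, ?_, s, fun t => ?_⟩
  · intro g hg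
    refine hu g ?_
    rw [← Ideal.Quotient.eq_zero_iff_mem, map_sum] at hg
    simpa only [map_mul, evalMod_apply] using hg
  let α := evalMod p y (homogeneousComponent s a)
  have hα : α ≠ 0 := by
    rw [← map_zero (evalMod p y)]
    exact hinj.ne hs
  let T : Fin ρ → Finset (Fin (n + 1) →₀ ℕ) :=
    fun j => Finset.finsuppAntidiag Finset.univ (t + s - δ j)
  let w : (Σ j, T j) → MvPolynomial σ k ⧸ p :=
    fun x => Ideal.Quotient.mk p (aeval y (monomial x.2.1 (1 : k)) * b x.1)
  let W := Submodule.span k (Set.range w)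
  have hle : (degreePart p t).map (LinearMap.mulLeft k α) ≤ W := by
    rintro _ ⟨_, ⟨f, hf, rfl⟩, rfl⟩
    have hf' : f.IsHomogeneous t := hf
    obtain ⟨g, hg⟩ := ha (Ideal.Quotient.mk p f)
    have hg' : aeval y a * f - ∑ j, aeval y (g j) * b j ∈ p := by
      rw [← Ideal.Quotient.eq_zero_iff_mem, map_sub, map_sum]
      simp only [map_mul]
      rw [sub_eq_zero]
      exact hg
    have hg2 := homogeneousComponent_mem_of_mem hp hg' (s + t)
    rw [map_sub, map_sum, homogeneousComponent_mul_of_isHomogeneous hf',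
      homogeneousComponent_aeval hy, ← Ideal.Quotient.eq_zero_iff_mem, map_sub, sub_eq_zero,
      map_mul] at hg2
    change α * Ideal.Quotient.mk p f ∈ W
    have hα' : α = Ideal.Quotient.mk p (aeval y (homogeneousComponent s a)) := rfl
    rw [hα', hg2, map_sum]
    refine Submodule.sum_mem _ fun j _ => ?_
    by_cases hj : δ j ≤ s + t
    · obtain ⟨q, hq⟩ := Nat.exists_eq_add_of_le' hj
      rw [hq, homogeneousComponent_mul_of_isHomogeneous (hb j), homogeneousComponent_aeval hy]
      set G := homogeneousComponent q (g j) with hG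
      have hGq : G.IsHomogeneous q := homogeneousComponent_isHomogeneous _ _
      rw [G.as_sum, map_sum, Finset.sum_mul, map_sum]
      refine Submodule.sum_mem _ fun v hv => ?_
      have hvq : v ∈ T j := by
        have hvd : v.degree = q := hGq.degree_eq_sum_deg_support hv ▸ rfl
        rw [mem_finsuppAntidiag_univ_iff]
        omega
      have h2 : (monomial v (coeff v G) : MvPolynomial (Fin (n + 1)) k)
          = coeff v G • monomial v 1 := by
        rw [smul_monomial, smul_eq_mul, mul_one]
      have h3 : Ideal.Quotient.mk p (aeval y (monomial v (coeff v G)) * b j)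
          = coeff v G • w ⟨j, v, hvq⟩ := by
        rw [h2, map_smul, smul_mul_assoc]
        rfl
      rw [h3]
      exact Submodule.smul_mem _ _ (Submodule.subset_span ⟨_, rfl⟩)
    · rw [homogeneousComponent_mul_eq_zero_of_lt (hb j) (by omega), map_zero]
      exact zero_mem _
  have hmul : Function.Injective (LinearMap.mulLeft k α) := fun r r' h =>
    mul_left_cancel₀ hα h
  have hW : Module.Finite k W := Module.Finite.span_of_finite k (Set.finite_range _)
  calc Module.finrank k (degreePart p t)
      = Module.finrank k ((degreePart p t).map (LinearMap.mulLeft k α)) :=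
        (Submodule.equivMapOfInjective _ hmul _).finrank_eq
    _ ≤ Module.finrank k W := Submodule.finrank_mono hle
    _ ≤ Fintype.card (Σ j, T j) := finrank_range_le_card _
    _ = ∑ j, (n + (t + s - δ j)).choose n := by
        rw [Fintype.card_sigma]
        refine Finset.sum_congr rfl fun j _ => ?_
        rw [Fintype.card_coe, card_finsuppAntidiag_fin]
    _ ≤ ∑ _j : Fin ρ, (n + (t + s)).choose n :=
        Finset.sum_le_sum fun j _ => Nat.choose_le_choose _ (by omega)
    _ = ρ * (n + (t + s)).choose n := by simp

end

/-! ### The degree read off from the growth of the Hilbert function -/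

open Filter Topology in
theorem tendsto_choose_div_pow {N : ℕ → ℕ} (hN : Tendsto (fun t => (N t : ℝ) / t) atTop (𝓝 1))
    (hN' : Tendsto N atTop atTop) (n : ℕ) :
    Tendsto (fun t : ℕ => ((N t).choose n : ℝ) / (t : ℝ) ^ n) atTop (𝓝 (1 / n.factorial)) := by
  have h1 := (isEquivalent_choose n).comp_tendsto hN'
  have h2 : Tendsto (fun t : ℕ => ((N t : ℝ) ^ n / n.factorial) / (t : ℝ) ^ n) atTop
      (𝓝 (1 / n.factorial)) := by
    have := (hN.pow n).div_const (n.factorial : ℝ)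
    rw [one_pow] at this
    refine this.congr fun t => ?_
    rw [div_pow]
    ring
  refine Asymptotics.IsEquivalent.tendsto_nhds ?_ h2
  exact (h1.symm.div (Asymptotics.IsEquivalent.refl (u := fun t : ℕ => (t : ℝ) ^ n)))

open Filter Topology in
theorem tendsto_shift_div (c s : ℕ) :
    Tendsto (fun t : ℕ => ((c + (t - s) : ℕ) : ℝ) / t) atTop (𝓝 1) := by
  have h1 : Tendsto (fun t : ℕ => 1 + ((c : ℝ) - s) / t) atTop (𝓝 (1 + 0)) :=
    tendsto_const_nhds.add (tendsto_const_div_atTop_nhds_zero_nat _)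
  rw [add_zero] at h1
  refine h1.congr' ?_
  filter_upwards [eventually_ge_atTop (s + 1)] with t ht
  have h0 : (t : ℝ) ≠ 0 := by
    have : t ≠ 0 := by omega
    exact_mod_cast this
  rw [Nat.cast_add, Nat.cast_sub (by omega)]
  field_simp
  ring

open Filter Topology in
/-- A polynomial that is eventually squeezed between shifts of `ρ` times the Hilbert polynomial of
`ℙ^n` has degree `n` and leading coefficient `ρ / n!` (or is zero, when `ρ` is). -/
theorem factorial_natDegree_mul_leadingCoeff_eq {P : Polynomial ℚ} {ρ n s s' : ℕ}
    (hlow : ∀ᶠ t : ℕ in atTop, (ρ * (n + (t - s')).choose n : ℚ) ≤ P.eval (t : ℚ))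
    (hup : ∀ᶠ t : ℕ in atTop, P.eval (t : ℚ) ≤ (ρ * (n + (t + s)).choose n : ℚ)) :
    (P.natDegree.factorial : ℚ) * P.leadingCoeff = ρ := by
  rcases Nat.eq_zero_or_pos ρ with rfl | hρ
  · have hP : P = 0 := by
      obtain ⟨N, hN⟩ := eventually_atTop.1 (hlow.and hup)
      refine Polynomial.eq_zero_of_infinite_isRoot P ?_
      refine Set.Infinite.mono (s := (fun t : ℕ => (t : ℚ)) '' Set.Ici N) ?_
        ((Set.Ici_infinite N).image Nat.cast_injective.injOn)
      rintro _ ⟨t, ht, rfl⟩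
      have := hN t ht
      simp only [Nat.cast_zero, zero_mul] at this
      exact le_antisymm this.2 this.1
    simp [hP]
  set Q : Polynomial ℝ := P.map (algebraMap ℚ ℝ) with hQ
  have hQeval : ∀ t : ℕ, Q.eval (t : ℝ) = ((P.eval (t : ℚ) : ℚ) : ℝ) := by
    intro t
    rw [hQ, ← map_natCast (algebraMap ℚ ℝ) t, Polynomial.eval_map_algebraMap,
      Polynomial.aeval_algebraMap_apply]
    simp
  have hlim : Tendsto (fun t : ℕ => Q.eval (t : ℝ) / ((Polynomial.X : Polynomial ℝ) ^ n).eval (t : ℝ))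
      atTop (𝓝 (ρ * (1 / n.factorial))) := by
    have hl := (tendsto_choose_div_pow (tendsto_shift_div n s')
      (tendsto_atTop_mono (fun t => Nat.le_add_left _ _) (tendsto_sub_atTop_nat s')) n).const_mul
        (ρ : ℝ)
    have hu := (tendsto_choose_div_pow (N := fun t => n + (t + s))
      ((tendsto_shift_div (n + s) 0).congr fun t => by rw [Nat.sub_zero]; congr 2; ring)
      (tendsto_atTop_mono (fun t => by omega : ∀ t, t ≤ n + (t + s)) tendsto_id) n).const_mul
        (ρ : ℝ)
    refine tendsto_of_tendsto_of_tendsto_of_le_of_le' hl hu ?_ ?_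
    · filter_upwards [hlow] with t ht
      rw [hQeval, ← mul_div_assoc]
      simp only [Polynomial.eval_pow, Polynomial.eval_X]
      refine div_le_div_of_nonneg_right ?_ (by positivity)
      exact_mod_cast ht
    · filter_upwards [hup] with t ht
      rw [hQeval, ← mul_div_assoc]
      simp only [Polynomial.eval_pow, Polynomial.eval_X]
      refine div_le_div_of_nonneg_right ?_ (by positivity)
      exact_mod_cast ht
  have hpos : (0 : ℝ) < ρ * (1 / n.factorial) := by positivity
  have hdeg : Q.degree = ((Polynomial.X : Polynomial ℝ) ^ n).degree := by
    rcases lt_trichotomy Q.degree ((Polynomial.X : Polynomial ℝ) ^ n).degree with h | h | h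
    · have := (Polynomial.div_tendsto_atTop_zero_of_degree_lt _ _ h).comp
        (tendsto_natCast_atTop_atTop (R := ℝ))
      exact absurd (tendsto_nhds_unique hlim this) hpos.ne'
    · exact h
    · have := (Polynomial.abs_div_tendsto_atTop_atTop_of_degree_gt _ _ h
        (pow_ne_zero _ Polynomial.X_ne_zero)).comp (tendsto_natCast_atTop_atTop (R := ℝ))
      exact absurd hlim.abs (not_tendsto_nhds_of_tendsto_atTop this _)
  have hlead := tendsto_nhds_unique hlim
    ((Polynomial.div_tendsto_atTop_leadingCoeff_div_of_degree_eq _ _ hdeg).comp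
      (tendsto_natCast_atTop_atTop (R := ℝ)))
  rw [Polynomial.leadingCoeff_X_pow, div_one, hQ, Polynomial.leadingCoeff_map] at hlead
  have hnat : P.natDegree = n := by
    rw [Polynomial.degree_X_pow, hQ, Polynomial.degree_map] at hdeg
    exact Polynomial.natDegree_eq_of_degree_eq_some hdeg
  have hlead' : P.leadingCoeff = ρ * (1 / n.factorial) := by
    have : ((P.leadingCoeff : ℚ) : ℝ) = ((ρ * (1 / n.factorial) : ℚ) : ℝ) := by
      push_cast
      exact hlead.symm
    exact_mod_cast this
  rw [hnat, hlead']
  field_simp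

namespace ProjSpace

/-! ### Projective sets and homogeneous prime ideals -/

section Ideals

variable {k : Type*} [Field k] {m : ℕ}

theorem coords_ne_zero (p : ProjSpace k m) : p.coords ≠ 0 :=
  Projectivization.rep_nonzero p

theorem vanishingIdeal_isHomogeneous (Z : Set (ProjSpace k m)) :
    (vanishingIdeal Z).IsHomogeneous (homogeneousSubmodule (Fin (m + 1)) k) :=
  Ideal.homogeneous_span _ _ fun _ hf => hf.1

theorem mem_vanishingIdeal_iff {Z : Set (ProjSpace k m)} {f : MvPolynomial (Fin (m + 1)) k} {n : ℕ}
    (hf : f.IsHomogeneous n) : f ∈ vanishingIdeal Z ↔ ∀ p ∈ Z, eval p.coords f = 0 :=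
  ⟨fun h _ hp => eval_eq_zero_of_mem_vanishingIdeal h hp,
    fun h => Ideal.subset_span ⟨⟨n, hf⟩, h⟩⟩

theorem vanishingIdeal_anti {Y Z : Set (ProjSpace k m)} (h : Y ⊆ Z) :
    vanishingIdeal Z ≤ vanishingIdeal Y :=
  Ideal.span_mono fun _ hf => ⟨hf.1, fun p hp => hf.2 p (h hp)⟩

theorem isClosed_vanishingSet {S : Set (MvPolynomial (Fin (m + 1)) k)}
    (hS : ∀ f ∈ S, ∃ n, f.IsHomogeneous n) : IsClosed (vanishingSet S) :=
  isClosed_iff.2 ⟨S, hS, rfl⟩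

theorem vanishingIdeal_isPrime {Z : Set (ProjSpace k m)} (hZ : IsIrreducible Z) :
    (vanishingIdeal Z).IsPrime := by
  refine (vanishingIdeal_isHomogeneous Z).isPrime_of_homogeneous_mem_or_mem ?_ ?_
  · obtain ⟨p, hp⟩ := hZ.nonempty
    intro h
    have := eval_eq_zero_of_mem_vanishingIdeal (f := 1) (h ▸ Submodule.mem_top) hp
    simp at this
  · rintro f g ⟨a, hf⟩ ⟨b, hg⟩ hfg
    have hf' : f.IsHomogeneous a := hf
    have hg' : g.IsHomogeneous b := hg
    rw [mem_vanishingIdeal_iff hf', mem_vanishingIdeal_iff hg']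
    have hclosed : ∀ {h : MvPolynomial (Fin (m + 1)) k} {n : ℕ}, h.IsHomogeneous n →
        IsClosed (vanishingSet {h}) := by
      intro h n hh
      refine isClosed_vanishingSet ?_
      rintro _ rfl
      exact ⟨n, hh⟩
    have h := isPreirreducible_iff_isClosed_union_isClosed.1 hZ.isPreirreducible _ _
      (hclosed hf') (hclosed hg') (by
        intro p hp
        have := eval_eq_zero_of_mem_vanishingIdeal hfg hp
        rw [map_mul, mul_eq_zero] at this
        simpa [vanishingSet] using this)
    refine h.imp (fun h p hp => ?_) (fun h p hp => ?_)
    · exact h hp f rfl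
    · exact h hp g rfl

/-- The homogeneous polynomials of an ideal. -/
def homogeneousElements (q : Ideal (MvPolynomial (Fin (m + 1)) k)) :
    Set (MvPolynomial (Fin (m + 1)) k) :=
  {f | f ∈ q ∧ ∃ n, f.IsHomogeneous n}

theorem isClosed_vanishingSet_homogeneousElements (q : Ideal (MvPolynomial (Fin (m + 1)) k)) :
    IsClosed (vanishingSet (homogeneousElements q)) :=
  isClosed_vanishingSet fun _ hf => hf.2

/-- The homogeneous Nullstellensatz for a homogeneous prime other than the irrelevant ideal. -/
theorem vanishingIdeal_vanishingSet [IsAlgClosed k] {q : Ideal (MvPolynomial (Fin (m + 1)) k)}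
    [q.IsPrime] (hq : q.IsHomogeneous (homogeneousSubmodule (Fin (m + 1)) k))
    (hX : ∃ i, X i ∉ q) : vanishingIdeal (vanishingSet (homogeneousElements q)) = q := by
  obtain ⟨i, hi⟩ := hX
  refine le_antisymm ?_ ?_
  · refine Ideal.span_le.2 ?_
    rintro f ⟨⟨n, hf⟩, hfq⟩
    -- Multiplying by a variable outside `q` makes the polynomial vanish at the origin as well.
    have hmul : f * X i ∈ q := by
      rw [← IsPrime.vanishingIdeal_zeroLocus (K := k) q, MvPolynomial.mem_vanishingIdeal_iff]
      intro v hv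
      rw [map_mul, aeval_X]
      by_cases hv0 : v = 0
      · simp [hv0]
      · have hp : (Projectivization.mk k v hv0 : ProjSpace k m) ∈
            vanishingSet (homogeneousElements q) := by
          rintro g ⟨hg, a, ha⟩
          rw [eval_coords_mk_eq_zero_iff ha]
          exact hv g hg
        have h0 := (eval_coords_mk_eq_zero_iff hf v hv0).1 (hfq _ hp)
        rw [aeval_eq_eval, h0, zero_mul]
    exact (Ideal.IsPrime.mem_or_mem ‹_› hmul).resolve_right hi
  · intro f hf
    rw [← sum_homogeneousComponent f]
    refine Submodule.sum_mem _ fun n _ => ?_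
    rw [ProjSpace.mem_vanishingIdeal_iff (homogeneousComponent_isHomogeneous n f)]
    exact fun p hp => hp _ ⟨homogeneousComponent_mem_of_mem hq hf n, n,
      homogeneousComponent_isHomogeneous n f⟩

theorem isIrreducible_vanishingSet [IsAlgClosed k] {q : Ideal (MvPolynomial (Fin (m + 1)) k)}
    [hprime : q.IsPrime] (hq : q.IsHomogeneous (homogeneousSubmodule (Fin (m + 1)) k))
    (hX : ∃ i, X i ∉ q) : IsIrreducible (vanishingSet (homogeneousElements q)) := by
  have hI := vanishingIdeal_vanishingSet hq hX
  constructor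
  · by_contra hne
    rw [Set.not_nonempty_iff_eq_empty] at hne
    refine hprime.ne_top ((Ideal.eq_top_iff_one _).2 ?_)
    rw [← hI, ProjSpace.mem_vanishingIdeal_iff (isHomogeneous_one _ _), hne]
    simp
  · rw [isPreirreducible_iff_isClosed_union_isClosed]
    intro Z₁ Z₂ h₁ h₂ hsub
    by_contra! hcon
    have hex : ∀ Z : Set (ProjSpace k m), IsClosed Z →
        ¬ vanishingSet (homogeneousElements q) ⊆ Z →
        ∃ f n, f.IsHomogeneous n ∧ (∀ p ∈ Z, eval p.coords f = 0) ∧ f ∉ q := by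
      intro Z hZ hnot
      by_contra! hall
      refine hnot (subset_of_vanishingIdeal_le hZ ?_)
      rw [hI]
      refine Ideal.span_le.2 ?_
      rintro f ⟨⟨n, hf⟩, hfZ⟩
      exact hall f n hf hfZ
    obtain ⟨f, a, hf, hfZ, hfq⟩ := hex Z₁ h₁ hcon.1
    obtain ⟨g, b, hg, hgZ, hgq⟩ := hex Z₂ h₂ hcon.2
    have hfg : f * g ∈ q := by
      rw [← hI, ProjSpace.mem_vanishingIdeal_iff (hf.mul hg)]
      intro p hp
      rw [map_mul]
      rcases hsub hp with h | h
      · rw [hfZ p h, zero_mul]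
      · rw [hgZ p h, mul_zero]
    exact (hprime.mem_or_mem hfg).elim hfq hgq

theorem isClosed_of_mem_components {X Z : Set (ProjSpace k m)} (hX : IsClosed X)
    (hZ : Z ∈ components X) : IsClosed Z := by
  obtain ⟨W, hW, rfl⟩ := hZ
  exact hX.isClosedEmbedding_subtypeVal.isClosedMap _ (isClosed_of_mem_irreducibleComponents _ hW)

theorem isIrreducible_of_mem_components {X Z : Set (ProjSpace k m)} (hZ : Z ∈ components X) :
    IsIrreducible Z := by
  obtain ⟨W, hW, rfl⟩ := hZ
  exact hW.1.image _ continuous_subtype_val.continuousOn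

theorem subset_of_mem_components {X Z : Set (ProjSpace k m)} (hZ : Z ∈ components X) : Z ⊆ X := by
  obtain ⟨W, hW, rfl⟩ := hZ
  exact Subtype.coe_image_subset X W

theorem eq_of_mem_components_of_subset {X Y Z : Set (ProjSpace k m)} (hY : Y ∈ components X)
    (hZ : Z ∈ components X) (h : Y ⊆ Z) : Y = Z := by
  obtain ⟨V, hV, rfl⟩ := hY
  obtain ⟨W, hW, rfl⟩ := hZ
  have h' : V ⊆ W := (Set.image_subset_image_iff Subtype.val_injective).1 h
  rw [h'.antisymm (hV.2 hW.1 h')]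

end Ideals

/-! ### Dimension -/

section Dimension

variable {k : Type*} [Field k] {m : ℕ}

theorem vanishingIdeal_lt_ker_constantCoeff {Z : Set (ProjSpace k m)} (hZ : Z.Nonempty) :
    vanishingIdeal Z < RingHom.ker (constantCoeff : MvPolynomial (Fin (m + 1)) k →+* k) := by
  obtain ⟨p, hp⟩ := hZ
  refine lt_of_le_of_ne (Ideal.span_le.2 ?_) ?_
  · rintro f ⟨⟨n, hf⟩, hfZ⟩
    change constantCoeff f = 0
    rcases Nat.eq_zero_or_pos n with rfl | hn
    · rw [← totalDegree_zero_iff_isHomogeneous] at hf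
      have h := hfZ p hp
      rw [totalDegree_eq_zero_iff_eq_C.1 hf] at h ⊢
      simpa using h
    · rw [constantCoeff_eq]
      exact hf.coeff_eq_zero (by simpa using hn.ne)
  · intro heq
    obtain ⟨i, hi⟩ := Function.ne_iff.1 (coords_ne_zero p)
    have hX : (X i : MvPolynomial (Fin (m + 1)) k) ∈ vanishingIdeal Z := by
      rw [heq, RingHom.mem_ker, constantCoeff_X]
    have := eval_eq_zero_of_mem_vanishingIdeal hX hp
    rw [eval_X] at this
    exact hi this

/-- A chain of irreducible closed subsets of `Z` gives a chain of homogeneous primes over `I(Z)`,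
which can be prolonged by the irrelevant ideal. -/
theorem topologicalKrullDim_add_one_le {Z : Set (ProjSpace k m)} (hZ : IsClosed Z)
    (hirr : IsIrreducible Z) :
    topologicalKrullDim Z + 1 ≤ ringKrullDim (MvPolynomial (Fin (m + 1)) k ⧸ vanishingIdeal Z) := by
  have hclosed : ∀ W : TopologicalSpace.IrreducibleCloseds Z,
      IsClosed (Subtype.val '' (W : Set Z)) := fun W =>
    hZ.isClosedEmbedding_subtypeVal.isClosedMap _ W.isClosed
  have hW : ∀ W : TopologicalSpace.IrreducibleCloseds Z,
      IsIrreducible (Subtype.val '' (W : Set Z)) := fun W =>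
    W.isIrreducible.image _ continuous_subtype_val.continuousOn
  have hne : Nonempty (TopologicalSpace.IrreducibleCloseds Z)ᵒᵈ := by
    have := Subtype.irreducibleSpace hirr
    exact ⟨⟨Set.univ, IrreducibleSpace.isIrreducible_univ _, isClosed_univ⟩⟩
  rw [ringKrullDim_quotient, topologicalKrullDim, ← Order.krullDim_orderDual,
    ← Order.krullDim_WithTop]
  let f : WithTop (TopologicalSpace.IrreducibleCloseds Z)ᵒᵈ →
      PrimeSpectrum.zeroLocus (R := MvPolynomial (Fin (m + 1)) k)
        (vanishingIdeal Z : Set (MvPolynomial (Fin (m + 1)) k)) := fun W =>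
    match W with
    | none => ⟨⟨RingHom.ker constantCoeff, RingHom.ker_isPrime _⟩,
        (vanishingIdeal_lt_ker_constantCoeff hirr.nonempty).le⟩
    | some W => ⟨⟨vanishingIdeal (Subtype.val '' ((OrderDual.ofDual W : TopologicalSpace.IrreducibleCloseds Z) : Set Z)),
        vanishingIdeal_isPrime (hW _)⟩, vanishingIdeal_anti (Subtype.coe_image_subset _ _)⟩
  refine Order.krullDim_le_of_strictMono f ?_
  intro V W hVW
  induction V using WithTop.recTopCoe with
  | top => exact absurd hVW not_top_lt
  | coe V =>
    induction W using WithTop.recTopCoe with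
    | top => exact vanishingIdeal_lt_ker_constantCoeff (hW _).nonempty
    | coe W =>
      have hlt : OrderDual.ofDual W < OrderDual.ofDual V :=
        OrderDual.ofDual_lt_ofDual.2 (WithTop.coe_lt_coe.1 hVW)
      change vanishingIdeal (Subtype.val '' ((OrderDual.ofDual V : TopologicalSpace.IrreducibleCloseds Z) : Set Z)) <
        vanishingIdeal (Subtype.val '' ((OrderDual.ofDual W : TopologicalSpace.IrreducibleCloseds Z) : Set Z))
      refine lt_of_le_not_ge (vanishingIdeal_anti (Set.image_mono hlt.le)) fun hle => ?_
      have hsub := subset_of_vanishingIdeal_le (hclosed _) hle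
      exact hlt.not_ge ((Set.image_subset_image_iff Subtype.val_injective).1 hsub)

/-- The prime ideal generated by the first `i` variables, described as the kernel of the
homomorphism that sets these variables to zero. -/
noncomputable def initialPrime (k : Type*) [Field k] (n i : ℕ) : Ideal (MvPolynomial (Fin n) k) :=
  RingHom.ker (aeval (fun j : Fin n => if (j : ℕ) < i then 0 else X j) :
    MvPolynomial (Fin n) k →ₐ[k] MvPolynomial (Fin n) k)

theorem mem_initialPrime_iff {n i : ℕ} {f : MvPolynomial (Fin n) k} : f ∈ initialPrime k n i ↔
    aeval (fun j : Fin n => if (j : ℕ) < i then 0 else (X j : MvPolynomial (Fin n) k)) f = 0 :=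
  Iff.rfl

instance initialPrime_isPrime (n i : ℕ) : (initialPrime k n i).IsPrime :=
  RingHom.ker_isPrime _

theorem initialPrime_zero (n : ℕ) : initialPrime k n 0 = ⊥ := by
  rw [eq_bot_iff]
  intro f hf
  rw [mem_initialPrime_iff] at hf
  simpa using hf

theorem X_mem_initialPrime_iff {n i : ℕ} {j : Fin n} : X j ∈ initialPrime k n i ↔ (j : ℕ) < i := by
  rw [mem_initialPrime_iff, aeval_X]
  split_ifs with h <;> simp [h]

theorem initialPrime_le_succ (n i : ℕ) : initialPrime k n i ≤ initialPrime k n (i + 1) := by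
  intro f hf
  rw [mem_initialPrime_iff] at hf ⊢
  have h := congrArg
    (aeval (fun j : Fin n => if (j : ℕ) < i + 1 then 0 else (X j : MvPolynomial (Fin n) k))) hf
  have hcomp : ∀ j : Fin n,
      aeval (fun j : Fin n => if (j : ℕ) < i + 1 then 0 else (X j : MvPolynomial (Fin n) k))
        (if (j : ℕ) < i then 0 else (X j : MvPolynomial (Fin n) k))
      = if (j : ℕ) < i + 1 then 0 else X j := by
    intro j
    by_cases hj : (j : ℕ) < i
    · rw [if_pos hj, if_pos (by omega), map_zero]
    · rw [if_neg hj, aeval_X]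
  rw [map_zero, ← AlgHom.comp_apply, comp_aeval] at h
  simp only [hcomp] at h
  exact h

theorem homogeneousComponent_mem_initialPrime {n i : ℕ} {f : MvPolynomial (Fin n) k}
    (hf : f ∈ initialPrime k n i) (d : ℕ) : homogeneousComponent d f ∈ initialPrime k n i := by
  rw [mem_initialPrime_iff] at hf ⊢
  rw [← homogeneousComponent_aeval, hf, map_zero]
  intro j
  split_ifs
  · exact isHomogeneous_zero _ _ _
  · exact isHomogeneous_X _ _

/-- Going up for homogeneous primes: the homogeneous core of a prime over a homogeneous prime is
again a prime over it. -/
theorem exists_homogeneous_prime_over {σ τ : Type*} {p q : Ideal (MvPolynomial σ k)} [q.IsPrime]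
    (hq : q.IsHomogeneous (homogeneousSubmodule σ k)) (hpq : p ≤ q) {y : τ → MvPolynomial σ k}
    (hy : ∀ i, (y i).IsHomogeneous 1) (hint : (evalMod p y).IsIntegral)
    {P : Ideal (MvPolynomial τ k)} [P.IsPrime]
    (hP : ∀ f ∈ P, ∀ d, homogeneousComponent d f ∈ P)
    (hqP : q.comap (aeval y : MvPolynomial τ k →ₐ[k] MvPolynomial σ k) ≤ P) :
    ∃ q' : Ideal (MvPolynomial σ k), q'.IsPrime ∧
      q'.IsHomogeneous (homogeneousSubmodule σ k) ∧ q ≤ q' ∧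
      q'.comap (aeval y : MvPolynomial τ k →ₐ[k] MvPolynomial σ k) = P := by
  have hintq := evalMod_isIntegral_of_le hpq hint
  obtain ⟨Q, hQ, hQP⟩ : ∃ Q : Ideal (MvPolynomial σ k ⧸ q), Q.IsPrime ∧
      Q.comap (evalMod q y) = P := by
    let : Algebra (MvPolynomial τ k) (MvPolynomial σ k ⧸ q) := (evalMod q y).toAlgebra
    have : Algebra.IsIntegral (MvPolynomial τ k) (MvPolynomial σ k ⧸ q) := ⟨hintq⟩
    refine Ideal.exists_ideal_over_prime_of_isIntegral_of_isDomain P ?_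
    intro f hf
    exact hqP (evalMod_eq_zero_iff.1 hf)
  let Q' := Q.comap (Ideal.Quotient.mk q)
  have hQ' : Q'.IsPrime := Ideal.comap_isPrime _ _
  have hqQ' : q ≤ Q' := by
    intro f hf
    change Ideal.Quotient.mk q f ∈ Q
    rw [Ideal.Quotient.eq_zero_iff_mem.2 hf]
    exact zero_mem _
  refine ⟨(Q'.homogeneousCore (homogeneousSubmodule σ k)).toIdeal, hQ'.homogeneousCore,
    HomogeneousIdeal.isHomogeneous _, ?_, ?_⟩
  · rw [← hq.toIdeal_homogeneousCore_eq_self]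
    exact Ideal.homogeneousCore_mono _ hqQ'
  · refine le_antisymm ?_ ?_
    · intro f hf
      have h : aeval y f ∈ Q' :=
        Ideal.toIdeal_homogeneousCore_le (homogeneousSubmodule σ k) Q' hf
      rw [← hQP]
      exact h
    · intro f hf
      change aeval y f ∈ (Q'.homogeneousCore (homogeneousSubmodule σ k)).toIdeal
      rw [← sum_homogeneousComponent f, map_sum]
      refine Submodule.sum_mem _ fun d _ => ?_
      refine Ideal.mem_homogeneousCore_of_homogeneous_of_mem
        ⟨d, isHomogeneous_aeval hy (homogeneousComponent_isHomogeneous d f)⟩ ?_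
      have h := hP f hf d
      rw [← hQP] at h
      exact h

theorem isIrreducible_preimage_val {α : Type*} [TopologicalSpace α] {V Z : Set α}
    (hV : IsIrreducible V) (hVZ : V ⊆ Z) : IsIrreducible (Subtype.val ⁻¹' V : Set Z) := by
  constructor
  · obtain ⟨x, hx⟩ := hV.nonempty
    exact ⟨⟨x, hVZ hx⟩, hx⟩
  · rintro _ _ ⟨u, hu, rfl⟩ ⟨v, hv, rfl⟩ ⟨x, hx, hxu⟩ ⟨y, hy, hyv⟩
    obtain ⟨w, hwV, hwu, hwv⟩ := hV.isPreirreducible u v hu hv ⟨x, hx, hxu⟩ ⟨y, hy, hyv⟩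
    exact ⟨⟨w, hVZ hwV⟩, hwV, hwu, hwv⟩

/-- An irreducible closed set that is contained in `Z`, as an irreducible closed subset of `Z`. -/
def irreducibleClosedsIn {α : Type*} [TopologicalSpace α] {V Z : Set α} (hV : IsIrreducible V)
    (hV' : IsClosed V) (hVZ : V ⊆ Z) : TopologicalSpace.IrreducibleCloseds Z where
  carrier := Subtype.val ⁻¹' V
  isIrreducible' := isIrreducible_preimage_val hV hVZ
  isClosed' := hV'.preimage continuous_subtype_val

theorem irreducibleClosedsIn_le_iff {α : Type*} [TopologicalSpace α] {V W Z : Set α}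
    (hV : IsIrreducible V) (hV' : IsClosed V) (hVZ : V ⊆ Z) (hW : IsIrreducible W)
    (hW' : IsClosed W) (hWZ : W ⊆ Z) :
    irreducibleClosedsIn hV hV' hVZ ≤ irreducibleClosedsIn hW hW' hWZ ↔ V ⊆ W :=
  ⟨fun h x hx => h (show (⟨x, hVZ hx⟩ : Z) ∈ irreducibleClosedsIn hV hV' hVZ from hx),
    fun h _ hx => h hx⟩

/-- A strict chain of homogeneous primes over `I(Z)`, none of them irrelevant, bounds the dimension
of `Z` from below. -/
theorem le_topologicalKrullDim_of_strictMono [IsAlgClosed k] {Z : Set (ProjSpace k m)}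
    (hZ : IsClosed Z) {n : ℕ} {q : Fin (n + 1) → Ideal (MvPolynomial (Fin (m + 1)) k)}
    (hq : StrictMono q) (hprime : ∀ i, (q i).IsPrime)
    (hhom : ∀ i, (q i).IsHomogeneous (homogeneousSubmodule (Fin (m + 1)) k))
    (hX : ∀ i, ∃ j, X j ∉ q i) (hqZ : ∀ i, vanishingIdeal Z ≤ q i) :
    (n : WithBot ℕ∞) ≤ topologicalKrullDim Z := by
  have hsub : ∀ i, vanishingSet (homogeneousElements (q i)) ⊆ Z := fun i =>
    subset_of_vanishingIdeal_le hZ (by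
      rw [vanishingIdeal_vanishingSet (hhom i) (hX i)]
      exact hqZ i)
  have hirr : ∀ i, IsIrreducible (vanishingSet (homogeneousElements (q i))) := fun i =>
    isIrreducible_vanishingSet (hhom i) (hX i)
  let W : Fin (n + 1) → TopologicalSpace.IrreducibleCloseds Z := fun i =>
    irreducibleClosedsIn (hirr i) (isClosed_vanishingSet_homogeneousElements (q i)) (hsub i)
  have hanti : StrictAnti W := by
    intro i j hij
    have hlt : q i < q j := hq hij
    refine lt_of_le_not_ge ((irreducibleClosedsIn_le_iff _ _ _ _ _ _).2
      fun p hp f hf => hp f ⟨hlt.le hf.1, hf.2⟩) fun hge => ?_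
    have hji := vanishingIdeal_anti ((irreducibleClosedsIn_le_iff _ _ _ _ _ _).1 hge)
    rw [vanishingIdeal_vanishingSet (hhom j) (hX j),
      vanishingIdeal_vanishingSet (hhom i) (hX i)] at hji
    exact hlt.not_ge hji
  have hmono : StrictMono fun i => OrderDual.toDual (W i) := fun i j hij => hanti hij
  have hlen := Order.LTSeries.length_le_krullDim (LTSeries.mk n _ hmono)
  rw [Order.krullDim_orderDual] at hlen
  exact hlen

/-- The chain of primes generated by the first `0, 1, …, n` variables lifts along an integral
extension to a chain of homogeneous primes. -/
theorem exists_chain_over_initialPrime {σ : Type*} {p : Ideal (MvPolynomial σ k)} (hp : p.IsPrime)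
    (hhom : p.IsHomogeneous (homogeneousSubmodule σ k)) {n : ℕ} {y : Fin n → MvPolynomial σ k}
    (hy : ∀ i, (y i).IsHomogeneous 1) (hinj : Function.Injective (evalMod p y))
    (hint : (evalMod p y).IsIntegral) :
    ∃ q : ℕ → Ideal (MvPolynomial σ k), Monotone q ∧ ∀ i, (q i).IsPrime ∧
      (q i).IsHomogeneous (homogeneousSubmodule σ k) ∧ p ≤ q i ∧
      (q i).comap (aeval y : MvPolynomial (Fin n) k →ₐ[k] MvPolynomial σ k)
        = initialPrime k n i := by
  let V : ℕ → Ideal (MvPolynomial σ k) → Prop := fun i q =>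
    q.IsPrime ∧ q.IsHomogeneous (homogeneousSubmodule σ k) ∧ p ≤ q ∧
      q.comap (aeval y : MvPolynomial (Fin n) k →ₐ[k] MvPolynomial σ k) = initialPrime k n i
  have hstep : ∀ i q, V i q → ∃ q', V (i + 1) q' ∧ q ≤ q' := by
    rintro i q ⟨h1, h2, h3, h4⟩
    obtain ⟨q', h1', h2', h3', h4'⟩ := exists_homogeneous_prime_over h2 h3 hy hint
      (P := initialPrime k n (i + 1)) (fun f hf => homogeneousComponent_mem_initialPrime hf)
      (h4.le.trans (initialPrime_le_succ _ _))
    exact ⟨q', ⟨h1', h2', h3.trans h3', h4'⟩, h3'⟩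
  choose! next hnext hle using hstep
  let q : ℕ → Ideal (MvPolynomial σ k) := fun i => Nat.rec p next i
  have hq : ∀ i, V i (q i) := by
    intro i
    induction i with
    | zero =>
      refine ⟨hp, hhom, le_rfl, ?_⟩
      rw [initialPrime_zero, eq_bot_iff]
      intro f hf
      exact evalMod_injective_iff.1 hinj f hf
    | succ i ih => exact hnext i _ ih
  exact ⟨q, monotone_nat_of_le_succ fun i => hle i _ (hq i), hq⟩

/-- If the homogeneous coordinate ring of `Z` contains a polynomial ring in `n + 1` linear forms over
which it is integral, then `Z` has dimension at least `n`. -/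
theorem le_topologicalKrullDim [IsAlgClosed k] {Z : Set (ProjSpace k m)} (hZ : IsClosed Z)
    (hirr : IsIrreducible Z) {n : ℕ} {y : Fin (n + 1) → MvPolynomial (Fin (m + 1)) k}
    (hy : ∀ i, (y i).IsHomogeneous 1) (hinj : Function.Injective (evalMod (vanishingIdeal Z) y))
    (hint : (evalMod (vanishingIdeal Z) y).IsIntegral) :
    (n : WithBot ℕ∞) ≤ topologicalKrullDim Z := by
  obtain ⟨q, hmono, hq⟩ := exists_chain_over_initialPrime (vanishingIdeal_isPrime hirr)
    (vanishingIdeal_isHomogeneous Z) hy hinj hint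
  have hyq : ∀ i j, y j ∈ q i ↔ (j : ℕ) < i := by
    intro i j
    rw [← X_mem_initialPrime_iff (k := k), ← (hq i).2.2.2, Ideal.mem_comap, aeval_X]
  refine le_topologicalKrullDim_of_strictMono hZ (q := fun i => q i) ?_ (fun i => (hq i).1)
    (fun i => (hq i).2.1) ?_ (fun i => (hq i).2.2.1)
  · intro i j hij
    refine lt_of_le_of_ne (hmono hij.le) fun heq => ?_
    have h := (hyq j i).2 hij
    have heq' : q i = q j := heq
    rw [← heq'] at h
    exact lt_irrefl _ ((hyq i i).1 h)
  · intro i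
    by_contra! hall
    have hlast : y (Fin.last n) ∈ q i := by
      have h1 : y (Fin.last n) ∈ homogeneousSubmodule (Fin (m + 1)) k 1 := hy _
      rw [homogeneousSubmodule_one_eq_span_X] at h1
      refine Submodule.span_induction ?_ (zero_mem _) (fun _ _ _ _ => add_mem) ?_ h1
      · rintro _ ⟨j, rfl⟩
        exact hall j
      · intro a f _ hf
        rw [smul_eq_C_mul]
        exact Ideal.mul_mem_left _ _ hf
    rw [hyq, Fin.val_last] at hlast
    have := i.2
    omega

end Dimension

end ProjSpace

/-! ### Components of the same dimension -/

theorem ringKrullDim_le_of_isIntegral {A R : Type*} [CommRing A] [CommRing R] {φ : A →+* R}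
    (hφ : φ.IsIntegral) : ringKrullDim R ≤ ringKrullDim A := by
  let : Algebra A R := φ.toAlgebra
  have : Algebra.IsIntegral A R := ⟨hφ⟩
  refine Order.krullDim_le_of_strictMono (PrimeSpectrum.comap φ) fun p q hpq => ?_
  exact Ideal.IsIntegral.comap_lt_comap (R := A) (I := p.asIdeal) (J := q.asIdeal) hpq

section

variable {k σ τ ι κ : Type*} [Field k]

theorem ringKrullDim_mvPolynomial_fin (n : ℕ) :
    ringKrullDim (MvPolynomial (Fin n) k) = n := by
  simp

/-- A ring that is integral over a polynomial ring in `n` variables and has dimension at least `n`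
contains this polynomial ring. -/
theorem evalMod_injective_of_le_ringKrullDim {p : Ideal (MvPolynomial σ k)} {n : ℕ}
    {y : Fin n → MvPolynomial σ k} (hint : (evalMod p y).IsIntegral)
    (hn : (n : WithBot ℕ∞) ≤ ringKrullDim (MvPolynomial σ k ⧸ p)) :
    Function.Injective (evalMod p y) := by
  rw [evalMod_injective_iff]
  by_contra! hcon
  obtain ⟨f, hf, hf0⟩ := hcon
  let ψ : MvPolynomial (Fin n) k ⧸ Ideal.span {f} →+* MvPolynomial σ k ⧸ p :=
    Ideal.Quotient.lift (Ideal.span {f}) (evalMod p y) (by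
      intro g hg
      have hle : Ideal.span {f} ≤ RingHom.ker (evalMod p y) := by
        rw [Ideal.span_singleton_le_iff_mem, RingHom.mem_ker]
        exact evalMod_eq_zero_iff.2 hf
      exact hle hg)
  have hψ : ψ.IsIntegral := by
    refine RingHom.IsIntegral.tower_top (Ideal.Quotient.mk (Ideal.span {f})) ψ ?_
    have h : ψ.comp (Ideal.Quotient.mk (Ideal.span {f})) = evalMod p y :=
      Ideal.Quotient.lift_comp_mk _ _ _
    rwa [h]
  have h1 := ringKrullDim_quotient_succ_le_of_nonZeroDivisor (mem_nonZeroDivisors_of_ne_zero hf0)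
  rw [ringKrullDim_mvPolynomial_fin] at h1
  have h2 : (n : WithBot ℕ∞) + 1 ≤ n :=
    (add_le_add_left (hn.trans (ringKrullDim_le_of_isIntegral hψ)) 1).trans h1
  have h3 : n + 1 ≤ n := by exact_mod_cast h2
  omega

theorem IndepMod.mono [Fintype ι] {I J : Ideal (MvPolynomial σ k)} (hIJ : I ≤ J)
    {y : τ → MvPolynomial σ k} {b : ι → MvPolynomial σ k} (h : IndepMod J y b) :
    IndepMod I y b := fun a ha => h a (hIJ ha)

theorem IndepMod.comp_injective [Fintype ι] [Fintype κ] {I : Ideal (MvPolynomial σ k)}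
    {y : τ → MvPolynomial σ k} {b : ι → MvPolynomial σ k} (h : IndepMod I y b) {e : κ → ι}
    (he : Function.Injective e) : IndepMod I y (b ∘ e) := by
  intro a ha
  have h1 : ∑ i, aeval y (a i) * (b ∘ e) i
      = ∑ i, aeval y (Function.extend e a 0 i) * b i := by
    refine Fintype.sum_of_injective e he _ _ (fun i hi => ?_) fun i => ?_
    · rw [Function.extend_apply' _ _ _ (by simpa using hi)]
      simp
    · rw [he.extend_apply]
      rfl
  rw [h1] at ha
  have h2 := h _ ha
  funext i
  have := congrFun h2 (e i)
  rwa [he.extend_apply] at this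

/-- Ranks add up over the intersection of pairwise incomparable primes: families that are
independent modulo the single primes combine to one that is independent modulo the intersection,
after multiplying each by an element of all the other primes. -/
theorem exists_indepMod_iInf [Fintype ι] {p : ι → Ideal (MvPolynomial σ k)}
    (hprime : ∀ i, (p i).IsPrime) (hp : ∀ i j, p i ≤ p j → i = j) {y : τ → MvPolynomial σ k}
    {ρ : ι → ℕ} {b : ∀ i, Fin (ρ i) → MvPolynomial σ k} (hb : ∀ i, IndepMod (p i) y (b i)) :
    ∃ v : (Σ i, Fin (ρ i)) → MvPolynomial σ k, IndepMod (⨅ i, p i) y v := by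
  classical
  have hex : ∀ i j, ∃ g, g ∉ p i ∧ (i ≠ j → g ∈ p j) := by
    intro i j
    by_cases hij : i = j
    · exact ⟨1, (Ideal.ne_top_iff_one _).1 (hprime i).ne_top, fun h => absurd hij h⟩
    · obtain ⟨g, hgj, hgi⟩ := SetLike.not_le_iff_exists.1 fun h => hij (hp j i h).symm
      exact ⟨g, hgi, fun _ => hgj⟩
  choose g hg hg' using hex
  let h : ι → MvPolynomial σ k := fun i => ∏ j, g i j
  have hh : ∀ i, h i ∉ p i := by
    intro i hi
    obtain ⟨j, -, hj⟩ := (hprime i).prod_mem_iff.1 hi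
    exact hg i j hj
  have hh' : ∀ i j, i ≠ j → h i ∈ p j := fun i j hij =>
    Ideal.mem_of_dvd _ (Finset.dvd_prod_of_mem (g i) (Finset.mem_univ j)) (hg' i j hij)
  refine ⟨fun x => h x.1 * b x.1 x.2, fun a ha => ?_⟩
  rw [Ideal.mem_iInf] at ha
  funext ⟨i, l⟩
  refine congrFun (hb i (fun l => a ⟨i, l⟩) ?_) l
  have h1 := ha i
  rw [Fintype.sum_sigma, ← Finset.add_sum_erase _ _ (Finset.mem_univ i)] at h1
  have h2 : ∑ j ∈ Finset.univ.erase i, ∑ l, aeval y (a ⟨j, l⟩) * (h j * b j l) ∈ p i := by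
    refine Submodule.sum_mem _ fun j hj => Submodule.sum_mem _ fun l _ => ?_
    exact Ideal.mul_mem_left _ _ (Ideal.mul_mem_right _ _ (hh' j i (Finset.ne_of_mem_erase hj)))
  have h3 := (Ideal.add_mem_iff_left _ h2).1 h1
  have h4 : ∑ l, aeval y (a ⟨i, l⟩) * (h i * b i l)
      = h i * ∑ l, aeval y (a ⟨i, l⟩) * b i l := by
    rw [Finset.mul_sum]
    exact Finset.sum_congr rfl fun l _ => by ring
  rw [h4] at h3
  exact ((hprime i).mem_or_mem h3).resolve_left (hh i)

end

namespace ProjSpace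

section

variable {k : Type*} [Field k] {m : ℕ}

/-- The degree of `Z` is at most the rank of the homogeneous coordinate ring over a polynomial ring
in `n + 1` linear forms. A polynomial that agrees with the Hilbert function at large integers makes
both equal. By Hilbert's theorem there always is one; the proof does without this theorem, as the
inequality would hold in its absence too, the degree then being `0` by convention. -/
theorem exists_indepMod_and_degree_le {Z : Set (ProjSpace k m)} (hirr : IsIrreducible Z) {n : ℕ}
    {y : Fin (n + 1) → MvPolynomial (Fin (m + 1)) k} (hy : ∀ i, (y i).IsHomogeneous 1)
    (hinj : Function.Injective (evalMod (vanishingIdeal Z) y))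
    (hint : (evalMod (vanishingIdeal Z) y).IsIntegral) :
    ∃ (ρ : ℕ) (b : Fin ρ → MvPolynomial (Fin (m + 1)) k),
      IndepMod (vanishingIdeal Z) y b ∧ degree Z ≤ ρ := by
  have := vanishingIdeal_isPrime hirr
  obtain ⟨ρ, b, δ, hb, hind, s, hs⟩ := exists_indepMod_and_finrank_degreePart_le
    (vanishingIdeal_isHomogeneous Z) hy hinj hint
  refine ⟨ρ, b, hind, ?_⟩
  rw [degree, hilbertPolynomial]
  split_ifs with h
  · have hP := h.choose_spec
    refine (factorial_natDegree_mul_leadingCoeff_eq (ρ := ρ) (n := n) (s := s) (s' := ∑ j, δ j)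
      ?_ ?_).le
    · filter_upwards [hP, Filter.eventually_ge_atTop (∑ j, δ j)] with t ht htδ
      rw [← ht]
      have hδ : ∀ j, δ j ≤ ∑ j, δ j := fun j =>
        Finset.single_le_sum (fun _ _ => Nat.zero_le _) (Finset.mem_univ j)
      have h1 := sum_choose_le_finrank_degreePart hy hind hb (t := t) fun j => (hδ j).trans htδ
      have h2 : ρ * (n + (t - ∑ j, δ j)).choose n ≤ ∑ j, (n + (t - δ j)).choose n := by
        have h3 : ∑ _j : Fin ρ, (n + (t - ∑ j, δ j)).choose n ≤ ∑ j, (n + (t - δ j)).choose n :=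
          Finset.sum_le_sum fun j _ => Nat.choose_le_choose _ (by have := hδ j; omega)
        simpa using h3
      exact_mod_cast h2.trans h1
    · filter_upwards [hP] with t ht
      rw [← ht]
      exact_mod_cast hs t
  · simp

/-- If the components of dimension `n` of a closed set `X` have total degree more than `c`, then its
homogeneous coordinate ring contains `c + 1` elements that are independent over a polynomial ring
in `n + 1` linear forms. -/
theorem exists_indepMod_of_lt_degInDim [IsAlgClosed k] {X : Set (ProjSpace k m)}
    (hX : IsClosed X) {n c : ℕ} (hc : (c : ℚ) < degInDim n X) :
    ∃ (y : Fin (n + 1) → MvPolynomial (Fin (m + 1)) k) (v : Fin (c + 1) → MvPolynomial (Fin (m + 1)) k),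
      (∀ i, (y i).IsHomogeneous 1) ∧ IndepMod (vanishingIdeal X) y v := by
  classical
  set T : Set (Set (ProjSpace k m)) := {Z ∈ components X | topologicalKrullDim Z = n} with hT
  have hTfin : T.Finite := (finite_components X).subset fun Z hZ => hZ.1
  have := hTfin.fintype
  have hclosed : ∀ Z : T, IsClosed (Z : Set (ProjSpace k m)) := fun Z =>
    isClosed_of_mem_components hX Z.2.1
  have hirr : ∀ Z : T, IsIrreducible (Z : Set (ProjSpace k m)) := fun Z =>
    isIrreducible_of_mem_components Z.2.1
  have hdim : ∀ Z : T, topologicalKrullDim (Z : Set (ProjSpace k m)) = n := fun Z => Z.2.2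
  have hsum : degInDim n X = ∑ Z : T, degree (Z : Set (ProjSpace k m)) := by
    rw [degInDim, ← hT, finsum_mem_eq_finite_toFinset_sum _ hTfin]
    exact Finset.sum_subtype _ (fun Z => by simp) _
  have hTne : Nonempty T := by
    by_contra hempty
    rw [not_nonempty_iff] at hempty
    rw [hsum, Finset.univ_eq_empty, Finset.sum_empty] at hc
    exact absurd hc (not_lt.2 (Nat.cast_nonneg c))
  let p : T → Ideal (MvPolynomial (Fin (m + 1)) k) := fun Z => vanishingIdeal Z
  have hprime : ∀ Z, (p Z).IsPrime := fun Z => vanishingIdeal_isPrime (hirr Z)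
  let J := ⨅ Z, p Z
  have hJle : ∀ Z, J ≤ p Z := fun Z => iInf_le p Z
  have hJhom : J.IsHomogeneous (homogeneousSubmodule (Fin (m + 1)) k) :=
    Ideal.IsHomogeneous.iInf fun Z => vanishingIdeal_isHomogeneous _
  have hJtop : J ≠ ⊤ := by
    obtain ⟨Z⟩ := hTne
    exact fun h => (hprime Z).ne_top (eq_top_iff.2 (h ▸ hJle Z))
  obtain ⟨N, y, hy, hinj, hint⟩ := exists_linear_noether_normalization hJhom hJtop
  have hintZ : ∀ Z, (evalMod (p Z) y).IsIntegral := fun Z => evalMod_isIntegral_of_le (hJle Z) hint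
  have hlow : ∀ Z, ((n + 1 : ℕ) : WithBot ℕ∞) ≤ ringKrullDim (MvPolynomial (Fin (m + 1)) k ⧸ p Z) := by
    intro Z
    have := topologicalKrullDim_add_one_le (hclosed Z) (hirr Z)
    rw [hdim Z] at this
    exact_mod_cast this
  -- Some component dominates the whole projective space of the linear forms.
  obtain ⟨Z₀, hZ₀⟩ : ∃ Z, Function.Injective (evalMod (p Z) y) := by
    by_contra! hcon
    simp only [evalMod_injective_iff] at hcon
    push Not at hcon
    choose f hf hf0 using hcon
    refine Finset.prod_ne_zero_iff.2 (fun Z _ => hf0 Z)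
      (evalMod_injective_iff.1 hinj (∏ Z, f Z) ?_)
    rw [Ideal.mem_iInf]
    intro Z
    exact Ideal.mem_of_dvd _ (map_dvd _ (Finset.dvd_prod_of_mem f (Finset.mem_univ Z))) (hf Z)
  obtain rfl : N = n + 1 := by
    have h1 : n + 1 ≤ N := by
      have := (hlow Z₀).trans (ringKrullDim_le_of_isIntegral (hintZ Z₀))
      rw [ringKrullDim_mvPolynomial_fin] at this
      exact_mod_cast this
    obtain ⟨N, rfl⟩ : ∃ N', N = N' + 1 := ⟨N - 1, by omega⟩
    have h2 := le_topologicalKrullDim (hclosed Z₀) (hirr Z₀) hy hZ₀ (hintZ Z₀)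
    rw [hdim Z₀] at h2
    have h3 : N ≤ n := by exact_mod_cast h2
    omega
  have hinjZ : ∀ Z, Function.Injective (evalMod (p Z) y) := fun Z =>
    evalMod_injective_of_le_ringKrullDim (hintZ Z) (hlow Z)
  choose ρ b hb hdeg using fun Z : T =>
    exists_indepMod_and_degree_le (hirr Z) hy (hinjZ Z) (hintZ Z)
  obtain ⟨v, hv⟩ := exists_indepMod_iInf hprime (fun Y Z hYZ => Subtype.ext
    (eq_of_mem_components_of_subset Z.2.1 Y.2.1
      (subset_of_vanishingIdeal_le (hclosed Y) hYZ)).symm) hb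
  have hcard : Fintype.card (Fin (c + 1)) ≤ Fintype.card (Σ Z, Fin (ρ Z)) := by
    have h1 : (c : ℚ) < ∑ Z, (ρ Z : ℚ) :=
      hc.trans_le (hsum.le.trans (Finset.sum_le_sum fun Z _ => hdeg Z))
    have h2 : c < ∑ Z, ρ Z := by exact_mod_cast h1
    simpa using h2
  obtain ⟨e⟩ := Function.Embedding.nonempty_of_card_le hcard
  refine ⟨y, v ∘ e, hy, IndepMod.mono ?_ (hv.comp_injective e.injective)⟩
  exact le_iInf fun Z => vanishingIdeal_anti (subset_of_mem_components Z.2.1)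

end

end ProjSpace

/-! ### Counting -/

section

variable {k : Type*} [Field k]

/-- With `c + 1` elements independent over `n + 1` linear forms modulo `I`, the Hilbert function of
`I` is at least that of a hypersurface of degree `c + 1` in `ℙ^(n + 1)`. -/
theorem IndepMod.sum_choose_le {σ : Type*} [Finite σ] {I : Ideal (MvPolynomial σ k)} {n c d : ℕ}
    {y : Fin (n + 1) → MvPolynomial σ k} (hy : ∀ i, (y i).IsHomogeneous 1)
    {v : Fin (c + 1) → MvPolynomial σ k} (hv : IndepMod I y v) (hcd : c ≤ d) :
    ∑ j ∈ Finset.range (c + 1), (n + (d - j)).choose n ≤ Module.finrank k (degreePart I d) := by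
  obtain ⟨u, hu, hind⟩ := hv.exists_monomial
  rw [Finset.sum_range]
  refine le_trans (Finset.sum_le_sum fun j _ => ?_)
    (sum_choose_le_finrank_degreePart hy hind (δ := fun j => (u j).degree)
      (fun j => isHomogeneous_monomial _ rfl) fun j => (hu j).trans (by omega))
  exact Nat.choose_le_choose _ (by have := hu j; omega)

theorem card_add_finrank_degreePart_le {m d r : ℕ} {I : Ideal (MvPolynomial (Fin (m + 1)) k)}
    {F : Fin r → MvPolynomial (Fin (m + 1)) k} (hF : ∀ i, (F i).IsHomogeneous d)
    (hFI : ∀ i, F i ∈ I) (hind : LinearIndependent k F) :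
    r + Module.finrank k (degreePart I d) ≤ (m + d).choose m := by
  let f : homogeneousSubmodule (Fin (m + 1)) k d →ₗ[k] MvPolynomial (Fin (m + 1)) k ⧸ I :=
    (Ideal.Quotient.mkₐ k I).toLinearMap.domRestrict (homogeneousSubmodule (Fin (m + 1)) k d)
  have hrange : LinearMap.range f = degreePart I d := LinearMap.range_domRestrict _ _
  have hker : r ≤ Module.finrank k (LinearMap.ker f) := by
    let w : Fin r → LinearMap.ker f := fun i => ⟨⟨F i, hF i⟩, Ideal.Quotient.eq_zero_iff_mem.2 (hFI i)⟩
    have hw : LinearIndependent k w :=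
      LinearIndependent.of_comp
        ((homogeneousSubmodule (Fin (m + 1)) k d).subtype ∘ₗ (LinearMap.ker f).subtype) hind
    simpa using hw.fintype_card_le_finrank
  have h := f.finrank_range_add_finrank_ker
  rw [hrange, finrank_homogeneousSubmodule_fin] at h
  omega

open scoped TensorProduct in
theorem linearIndependent_map_algebraMap {K L ι σ : Type*} [Field K] [Field L] [Algebra K L]
    {F : ι → MvPolynomial σ K} (hF : LinearIndependent K F) :
    LinearIndependent L fun i => map (algebraMap K L) (F i) := by
  have h := (Module.Flat.linearIndependent_one_tmul (S := L) hF).map'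
    (algebraTensorAlgEquiv (σ := σ) K L).toLinearMap
    (LinearMap.ker_eq_bot.2 (algebraTensorAlgEquiv (σ := σ) K L).injective)
  have heq : (fun i => map (algebraMap K L) (F i)) =
      (algebraTensorAlgEquiv (σ := σ) K L).toLinearMap ∘ fun i => 1 ⊗ₜ[K] F i := by
    ext1 i
    simp [algebraTensorAlgEquiv_tmul]
  rw [heq]
  exact h

end

theorem sum_range_choose_add_choose {n d c : ℕ} (hcd : c ≤ d) :
    ∑ j ∈ Finset.range (c + 1), (n + (d - j)).choose n + (n + (d - c)).choose (n + 1)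
      = (n + d + 1).choose (n + 1) := by
  induction c with
  | zero => simp [Nat.choose_succ_succ' (n + d) n]
  | succ c ih =>
    rw [← ih (by omega), Finset.sum_range_succ _ (c + 1)]
    have h : n + (d - c) = n + (d - (c + 1)) + 1 := by omega
    rw [h, Nat.choose_succ_succ']
    ring

theorem binom_eq_choose {n d c : ℕ} (hcd : c ≤ d) :
    binom (n + (d - c)) ((d : ℤ) - c - 1) = (n + (d - c)).choose (n + 1) := by
  rw [binom]
  split_ifs with h
  · have h1 : ((d : ℤ) - c - 1).toNat = d - c - 1 := by omega
    rw [h1]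
    have h2 : n + (d - c) = n + 1 + (d - c - 1) := by omega
    rw [h2, Nat.choose_symm_add]
  · rw [Nat.choose_eq_zero_of_lt]
    omega

theorem proposition1p7 (K : Type*) [Field K] [Finite K]
    (L : Type*) [Field L] [Algebra K L] [IsAlgClosure K L]
    (m d l c r : ℕ) (hl : 1 ≤ l) (hlm : l ≤ m) (hc : 1 ≤ c) (hcd : c ≤ d)
    (hr : ((m + d).choose d : ℤ) - ((m + d + 1 - l).choose d : ℤ)
      + (binom (m + d - l - c) ((d : ℤ) - c - 1) : ℤ) < r)
    (hr' : r ≤ (m + d).choose d)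
    (F : Fin r → MvPolynomial (Fin (m + 1)) K) (hF : ∀ i, (F i).IsHomogeneous d)
    (hind : LinearIndependent K F) :
    ProjSpace.degInDim (m - l)
      (ProjSpace.vanishingSet
        (Set.range fun i => MvPolynomial.map (algebraMap K L) (F i))) ≤ (c : ℚ) := by
  have : IsAlgClosed L := IsAlgClosure.isAlgClosed K
  by_contra! hlt
  obtain ⟨n, rfl⟩ := Nat.exists_eq_add_of_le' hlm
  rw [Nat.add_sub_cancel] at hlt
  have hF' : ∀ i, (map (algebraMap K L) (F i)).IsHomogeneous d := fun i => (hF i).map _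
  obtain ⟨y, v, hy, hv⟩ := ProjSpace.exists_indepMod_of_lt_degInDim
    (ProjSpace.isClosed_vanishingSet (by
      rintro _ ⟨i, rfl⟩
      exact ⟨d, hF' i⟩)) hlt
  have h1 := hv.sum_choose_le hy hcd
  have h2 := card_add_finrank_degreePart_le hF'
    (I := ProjSpace.vanishingIdeal (ProjSpace.vanishingSet
      (Set.range fun i => map (algebraMap K L) (F i))))
    (fun i => (ProjSpace.mem_vanishingIdeal_iff (hF' i)).2 fun p hp => hp _ ⟨i, rfl⟩)
    (linearIndependent_map_algebraMap (L := L) hind)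
  have h3 := sum_range_choose_add_choose (n := n) hcd
  rw [show n + l + d + 1 - l = n + d + 1 by omega, show n + l + d - l - c = n + (d - c) by omega,
    binom_eq_choose hcd] at hr
  have h4 : (n + d + 1).choose d = (n + d + 1).choose (n + 1) := by
    rw [show n + d + 1 = n + 1 + d by ring, Nat.choose_symm_add]
  have h5 : (n + l + d).choose d = (n + l + d).choose (n + l) := Nat.choose_symm_add.symm
  rw [h4, h5] at hr
  omega
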